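/- Let $\lambda\in(0,\infty)$, $\beta\in(0,1)$ and $\psi_1\in(0,\infty)$, and let $\psi:(0,1)\to[0,\infty)$ be a function with $\lim_{x\uparrow1}\psi(x)=\psi_1$ such that $x\mapsto\psi(x)(1-x)^\beta$, $x\in(0,1)$, is a probability density. A randomized INAR(1) process with Poisson innovations of parameter $\lambda$ and mixing variable $\alpha$ is a process $(X_k)_{k\ge0}$ given by $$X_k=\sum_{i=1}^{X_{k-1}}\xi_{k,i}+\varepsilon_k,\qquad k\ge1,$$ where $\alpha$ is a random variable with values in $(0,1)$ and $X_0,\ \xi_{k,i},\ \varepsilon_k$ ($k,i\ge1$) are conditionally independent given $\alpha$, with $$P(\xi_{k,i}=1\mid\alpha)=\alpha=1-P(\xi_{k,i}=0\mid\alpha),\qquad P(\varepsilon_k=\ell\mid\alpha)=\frac{\lambda^\ell}{\ell!}e^{-\lambda},\qquad P(X_0=\ell\mid\alpha)=\frac{\lambda^\ell}{\ell!(1-\alpha)^\ell}e^{-\lambda/(1-\alpha)}$$ for all integers $\ell\ge0$. Let $(\alpha^{(j)},(X^{(j)}_k)_{k\ge0})$, $j\ge1$, be independent copies of such a pair $(\alpha,(X_k)_{k\ge0})$,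 where $\alpha$ has the density $\psi(x)(1-x)^\beta$ on $(0,1)$. For integers $N,n\ge1$ and $t\ge0$ put $$\widetilde S^{(N,n)}_t=\sum_{j=1}^N\sum_{k=1}^{\lfloor nt\rfloor}\bigl(X^{(j)}_k-E(X^{(j)}_k\mid\alpha^{(j)})\bigr)$$ (here $E(X^{(j)}_k\mid\alpha^{(j)})=\lambda/(1-\alpha^{(j)})$ almost surely). Let $(\mathcal B_{1-\beta/2}(t))_{t\ge0}$ be a fractional Brownian motion with Hurst index $1-\beta/2$, that is, a Gaussian process with mean zero and covariances $\frac12\bigl(t_1^{2-\beta}+t_2^{2-\beta}-|t_2-t_1|^{2-\beta}\bigr)$, $t_1,t_2\ge0$. Then for each $n\ge1$ the finite-dimensional distributions of the process $\bigl(n^{-1+\beta/2}N^{-1/2}\,\widetilde S^{(N,n)}_t\bigr)_{t\ge0}$ converge weakly, as $N\to\infty$, to those of some process $Z^{(n)}=(Z^{(n)}_t)_{t\ge0}$, and the finite-dimensional distributions of $Z^{(n)}$ converge weakly, as $n\to\infty$, to those of $$\sqrt{\frac{2\lambda\psi_1\Gamma(\beta)}{(2-\beta)(1-\beta)}}\;\mathcal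 B_{1-\beta/2}.$$ -/

import Mathlib

open MeasureTheory ProbabilityTheory Filter Topology
open scoped NNReal ENNReal Nat

noncomputable section

/-- Index set of the random inputs of a Galton-Watson process with immigration: the initial value,
the innovations `ε k`, and the offspring variables `ξ k i`. -/
inductive InarIndex where
  | initial : InarIndex
  | innovation (k : ℕ) : InarIndex
  | offspring (k i : ℕ) : InarIndex

/-- The inputs (initial value, innovations, offspring variables) as a single family. -/
def inarInput {Ω : Type*} (X₀ : Ω → ℕ) (ε : ℕ → Ω → ℕ) (ξ : ℕ → ℕ → Ω → ℕ) :
    InarIndex → Ω → ℕ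
  | .initial => X₀
  | .innovation k => ε k
  | .offspring k i => ξ k i

/-- Conditional independence, given the sub-σ-algebra `m`, of a family of `ℕ`-valued random
variables, on an arbitrary probability space: conditional probabilities of finite intersections
are a.s. the products of the conditional probabilities. -/
def CondIndepGiven {Ω ι : Type*} (m : MeasurableSpace Ω) {mΩ : MeasurableSpace Ω}
    (Z : ι → Ω → ℕ) (P : Measure[mΩ] Ω) : Prop :=
  ∀ (s : Finset ι) (A : ι → Set ℕ),
    P⟦⋂ i ∈ s, Z i ⁻¹' A i | m⟧ =ᵐ[P] ∏ i ∈ s, P⟦Z i ⁻¹' A i | m⟧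

/-- The σ-algebra generated by a real random variable. -/
abbrev sigmaOf {Ω : Type*} (α : Ω → ℝ) : MeasurableSpace Ω :=
  MeasurableSpace.comap α inferInstance

/-- `X` is a randomized INAR(1) process with Poisson innovations of parameter `lam`, with random
thinning parameter `α`, driven by the innovations `ε` and the offspring variables `ξ`.
Indices are shifted by one: `ε k` and `ξ k i` are used for the step from time `k` to time
`k + 1`. -/
structure IsRandomizedInar {Ω : Type*} [MeasurableSpace Ω] (P : Measure Ω) (lam : ℝ)
    (α : Ω → ℝ) (X : ℕ → Ω → ℕ) (ε : ℕ → Ω → ℕ) (ξ : ℕ → ℕ → Ω → ℕ) : Prop where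
  measurable_param : Measurable α
  measurable_initial : Measurable (X 0)
  measurable_innovation : ∀ k, Measurable (ε k)
  measurable_offspring : ∀ k i, Measurable (ξ k i)
  param_mem : ∀ᵐ ω ∂P, α ω ∈ Set.Ioo (0 : ℝ) 1
  condIndep : CondIndepGiven (sigmaOf α) (inarInput (X 0) ε ξ) P
  offspring_one : ∀ k i, P⟦ξ k i ⁻¹' {1} | sigmaOf α⟧ =ᵐ[P] fun ω => α ω
  offspring_zero : ∀ k i, P⟦ξ k i ⁻¹' {0} | sigmaOf α⟧ =ᵐ[P] fun ω => 1 - α ω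
  innovation_law : ∀ k l,
    P⟦ε k ⁻¹' {l} | sigmaOf α⟧ =ᵐ[P] fun _ => lam ^ l / (l ! : ℝ) * Real.exp (-lam)
  initial_law : ∀ l,
    P⟦X 0 ⁻¹' {l} | sigmaOf α⟧ =ᵐ[P] fun ω =>
      lam ^ l / ((l ! : ℝ) * (1 - α ω) ^ l) * Real.exp (-(lam / (1 - α ω)))
  recursion : ∀ k ω, X (k + 1) ω = (∑ i ∈ Finset.range (X k ω), ξ k i ω) + ε k ω

/-- The doubly aggregated process, centred by the conditional expectations:
`∑_{j<N} ∑_{k=1}^{⌊nt⌋} (X^{(j)}_k - E(X^{(j)}_k | α^{(j)}))`. -/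
def aggregated {Ω : Type*} [MeasurableSpace Ω] (P : Measure Ω) (α : ℕ → Ω → ℝ)
    (X : ℕ → ℕ → Ω → ℕ) (N n : ℕ) (t : ℝ≥0) (ω : Ω) : ℝ :=
  ∑ j ∈ Finset.range N, ∑ k ∈ Finset.Icc 1 ⌊(n : ℝ) * (t : ℝ)⌋₊,
    ((X j k ω : ℝ) - (P[fun ω' => (X j k ω' : ℝ) | sigmaOf (α j)]) ω)

/-- A fractional Brownian motion with Hurst index `H`: a centred Gaussian process with the
fractional covariance function. -/
structure IsFractionalBM {Ω : Type*} [MeasurableSpace Ω] (H : ℝ) (B : ℝ≥0 → Ω → ℝ)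
    (P : Measure Ω) : Prop where
  gaussian : IsGaussianProcess B P
  mean_zero : ∀ t, P[B t] = 0
  covariance_eq : ∀ s t : ℝ≥0,
    cov[B s, B t; P]
      = ((s : ℝ) ^ (2 * H) + (t : ℝ) ^ (2 * H) - |(t : ℝ) - (s : ℝ)| ^ (2 * H)) / 2

/-- Weak convergence of all finite-dimensional distributions of the processes `Y i` (under `P i`)
to those of the process `Z` (under `Q`). -/
def FddTendsto {ι T Ω' : Type*} {Ω : ι → Type*} [∀ i, MeasurableSpace (Ω i)]
    [MeasurableSpace Ω'] (Y : (i : ι) → T → Ω i → ℝ) (l : Filter ι) (Z : T → Ω' → ℝ)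
    (P : (i : ι) → Measure (Ω i)) [∀ i, IsProbabilityMeasure (P i)]
    (Q : Measure Ω') [IsProbabilityMeasure Q] : Prop :=
  ∀ I : Finset T, TendstoInDistribution (fun i ω => I.restrict (fun t => Y i t ω)) l
    (fun ω => I.restrict (fun t => Z t ω)) P Q

/-- The iterated limit, first in `N` and then in `n`, of the finite-dimensional distributions of
the processes `Y N n` is `Z`: for each `n ≥ 1` the processes `Y N n` converge as `N → ∞` to some
process, which is realized as the coordinate process on path space under its law `ν n`, and these
processes converge to `Z` as `n → ∞`. -/
def IteratedFddLimit {T Ω Ω' : Type*} [MeasurableSpace Ω] [MeasurableSpace Ω']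
    (Y : ℕ → ℕ → T → Ω → ℝ) (P : Measure Ω) [IsProbabilityMeasure P]
    (Z : T → Ω' → ℝ) (Q : Measure Ω') [IsProbabilityMeasure Q] : Prop :=
  ∃ ν : ℕ → ProbabilityMeasure (T → ℝ),
    (∀ n, 1 ≤ n → FddTendsto (fun N => Y N n) atTop (fun t (x : T → ℝ) => x t)
      (fun _ => P) (ν n : Measure (T → ℝ))) ∧
    FddTendsto (fun _ t (x : T → ℝ) => x t) atTop Z
      (fun n => (ν n : Measure (T → ℝ))) Q

end

/-! Given `α`, the process is a stationary INAR(1) chain with Poisson marginals of mean `m = lam /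
(1 - α)`, and its conditional covariance at lag `d` is `α ^ d * m`. The centred process therefore
has covariances `r d = E[α ^ d * m] = lam * ∫ x ^ d * ψ x * (1 - x) ^ (β - 1)`. Only the behaviour
of the density near `1` matters for large `d`, and comparison with a Beta integral gives `r d ~ lam
* ψ₁ * Γ(β) * d ^ (-β)` (`tendsto_rpow_mul_integral_pow_mul`). These covariances are not summable,
which produces long memory.

For fixed `n` the copies are i.i.d. with finite variance, so the central limit theorem and the
Cramér-Wold device give, as `N → ∞`, the partial sums of a Gaussian sequence with covariances `r`,
scaled by `n ^ (-1 + β / 2)`. Such a sequence is built by Gram-Schmidt from i.i.d. normals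
(`exists_gaussian_sequence`). As `n → ∞` all laws are centred Gaussian, so only covariances must
converge. A sum of `r |k - l|` over a rectangle is half of a signed combination of sums over three
squares (`sum_rectangle_eq`), and the sum over a square of side `m` grows like `2c / ((1 - β)(2 -
β)) * m ^ (2 - β)` when `r m ~ c * m ^ (-β)`. This is exactly the fractional Brownian covariance.
`iteratedFddLimit_of_covariance` carries out both limits.

The moments are obtained on the space of parameter and inputs. `IsInputLaw` says that each input can
be integrated out given everything else; it follows from conditional independence
(`IsRandomizedInar.isInputLaw`), and it yields the recursions for the first two factorial moments as
well as the equality in law of the copies (`IsInputLaw.eq_of_map_fst_eq`). One difficulty is that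
`E[m ^ 2]` is infinite, so covariances are first computed with `α` bounded away from `1`; the answer
involves only `m` to the first power, and `E[m]` is finite because `β > 0`. -/

/-! ### Convergence to Gaussian limits and construction of Gaussian sequences. -/

section GaussianLimits

/-- The inner product in the exponent is itself the scalar linear combination. The passage to
`EuclideanSpace` supplies the inner product that `charFun` requires. -/
theorem charFun_map_toLp_eq {I Ω₀ : Type*} [Fintype I] [MeasurableSpace Ω₀] {μ : Measure Ω₀}
    {W : Ω₀ → I → ℝ} (hW : AEMeasurable W μ) (t : EuclideanSpace ℝ I) :
    charFun (μ.map (fun ω => WithLp.toLp 2 (W ω))) t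
      = charFun (μ.map (fun ω => ∑ i, t i * W ω i)) 1 := by
  rw [charFun_apply, charFun_apply, integral_map, integral_map]
  · simp [PiLp.inner_apply]
  · exact Finset.aemeasurable_fun_sum _ fun i _ =>
      ((measurable_pi_apply i).comp_aemeasurable hW).const_mul _
  · exact Measurable.aestronglyMeasurable (by fun_prop)
  · exact (PiLp.continuous_toLp 2 _).measurable.comp_aemeasurable hW
  · exact Measurable.aestronglyMeasurable (by fun_prop)

/-- Cramér-Wold device: convergence in distribution of all linear combinations of the coordinates
implies convergence in distribution of the random vectors. -/
theorem tendstoInDistribution_pi_of_linear {I Ω' : Type*} [Fintype I] {Ω : ℕ → Type*}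
    [∀ n, MeasurableSpace (Ω n)] [MeasurableSpace Ω'] {Y : (n : ℕ) → Ω n → I → ℝ}
    {Z : Ω' → I → ℝ} {P : (n : ℕ) → Measure (Ω n)} [∀ n, IsProbabilityMeasure (P n)]
    {Q : Measure Ω'} [IsProbabilityMeasure Q]
    (hY : ∀ n, AEMeasurable (Y n) (P n)) (hZ : AEMeasurable Z Q)
    (h : ∀ v : I → ℝ, TendstoInDistribution (fun n ω => ∑ i, v i * Y n ω i) atTop
      (fun ω => ∑ i, v i * Z ω i) P Q) :
    TendstoInDistribution Y atTop Z P Q := by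
  have hcont : Continuous (fun x : I → ℝ => WithLp.toLp 2 x) := PiLp.continuous_toLp 2 _
  have hY' : ∀ n, AEMeasurable (fun ω => WithLp.toLp 2 (Y n ω)) (P n) := fun n =>
    hcont.measurable.comp_aemeasurable (hY n)
  have hZ' : AEMeasurable (fun ω => WithLp.toLp 2 (Z ω)) Q :=
    hcont.measurable.comp_aemeasurable hZ
  have key : TendstoInDistribution (fun n ω => WithLp.toLp 2 (Y n ω)) atTop
      (fun ω => WithLp.toLp 2 (Z ω)) P Q := by
    refine ⟨hY', hZ', ?_⟩
    refine ProbabilityMeasure.tendsto_iff_tendsto_charFun.2 fun t => ?_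
    have h1 := ProbabilityMeasure.tendsto_iff_tendsto_charFun.1 (h t).tendsto 1
    simp only [ProbabilityMeasure.coe_mk] at h1 ⊢
    rw [charFun_map_toLp_eq hZ]
    simp_rw [fun n => charFun_map_toLp_eq (hY n) t]
    exact h1
  exact key.continuous_comp (PiLp.continuous_ofLp 2 _)

/-- Centred Gaussian laws converge when their variances do. -/
theorem tendstoInDistribution_of_hasLaw_gaussianReal {Ω' : Type*} {Ω : ℕ → Type*}
    [∀ n, MeasurableSpace (Ω n)] [MeasurableSpace Ω'] {Y : (n : ℕ) → Ω n → ℝ}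
    {Z : Ω' → ℝ} {P : (n : ℕ) → Measure (Ω n)} [∀ n, IsProbabilityMeasure (P n)]
    {Q : Measure Ω'} [IsProbabilityMeasure Q] {s : ℕ → ℝ} {s₀ : ℝ}
    (hY : ∀ n, HasLaw (Y n) (gaussianReal 0 (s n).toNNReal) (P n))
    (hZ : HasLaw Z (gaussianReal 0 s₀.toNNReal) Q) (hs : Tendsto s atTop (𝓝 s₀)) :
    TendstoInDistribution Y atTop Z P Q := by
  refine ⟨fun n => (hY n).aemeasurable, hZ.aemeasurable, ?_⟩
  refine ProbabilityMeasure.tendsto_iff_tendsto_charFun.2 fun t => ?_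
  simp only [ProbabilityMeasure.coe_mk, hZ.map_eq, fun n => (hY n).map_eq, charFun_gaussianReal]
  have h1 : Tendsto (fun n => (((s n).toNNReal : ℝ) : ℂ)) atTop (𝓝 ((s₀.toNNReal : ℝ) : ℂ)) :=
    (Complex.continuous_ofReal.tendsto _).comp <|
      (NNReal.continuous_coe.tendsto _).comp <| (continuous_real_toNNReal.tendsto _).comp hs
  refine (Complex.continuous_exp.tendsto _).comp ?_
  exact tendsto_const_nhds.sub ((h1.mul_const _).div_const _)

/-- Characteristic functions of independent variables multiply, so the variances add up in the
exponent. -/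
theorem hasLaw_sum_infinitePi_gaussianReal (s : Finset ℕ) (a : ℕ → ℝ) :
    HasLaw (fun x : ℕ → ℝ => ∑ i ∈ s, a i * x i)
      (gaussianReal 0 (∑ i ∈ s, a i ^ 2).toNNReal)
      (Measure.infinitePi (fun _ : ℕ => gaussianReal 0 1)) := by
  refine ⟨Measurable.aemeasurable (by fun_prop), Measure.ext_of_charFun ?_⟩
  ext t
  have hi : iIndepFun (fun i (x : ℕ → ℝ) => a i * x i)
      (Measure.infinitePi (fun _ : ℕ => gaussianReal 0 1)) :=
    iIndepFun_infinitePi (X := fun i y => a i * y) (by fun_prop)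
  have hlaw : ∀ i, (Measure.infinitePi (fun _ : ℕ => gaussianReal 0 1)).map
      (fun x : ℕ → ℝ => a i * x i) = gaussianReal 0 (a i ^ 2).toNNReal := by
    intro i
    have h1 : HasLaw (fun x : ℕ → ℝ => x i) (gaussianReal 0 1)
        (Measure.infinitePi (fun _ : ℕ => gaussianReal 0 1)) :=
      ⟨Measurable.aemeasurable (by fun_prop), Measure.infinitePi_map_eval _ i⟩
    have h2 := (gaussianReal_const_mul h1 (a i)).map_eq
    rw [h2]
    congr 1
    · simp
    · ext; simp [sq_nonneg]
  rw [(hi.restrict _).charFun_map_fun_finsetSum_eq_prod (fun _ _ => Measurable.aemeasurable (by fun_prop))]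
  simp only [Finset.prod_apply, hlaw, charFun_gaussianReal, ← Complex.exp_sum]
  congr 1
  have : ((∑ i ∈ s, a i ^ 2).toNNReal : ℝ) = ∑ i ∈ s, a i ^ 2 :=
    Real.coe_toNNReal _ (Finset.sum_nonneg fun _ _ => sq_nonneg _)
  rw [this]
  simp only [Real.coe_toNNReal _ (sq_nonneg _)]
  push_cast
  simp [Finset.sum_mul, Finset.sum_div]

-- Gram-Schmidt is triangular: `f k` involves only the directions up to `k`, and later ones
-- contribute zero. Linear dependence is allowed; a degenerate direction is the zero vector and
-- drops out.
open InnerProductSpace in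
theorem eq_sum_inner_gramSchmidtNormed {H : Type*} [NormedAddCommGroup H] [InnerProductSpace ℝ H]
    (f : ℕ → H) {k M : ℕ} (hk : k < M) :
    f k = ∑ i ∈ Finset.range M,
      inner ℝ (gramSchmidtNormed ℝ f i) (f k) • gramSchmidtNormed ℝ f i := by
  have hterm : ∀ i, inner ℝ (gramSchmidtNormed ℝ f i) (f k) • gramSchmidtNormed ℝ f i
      = (inner ℝ (gramSchmidt ℝ f i) (f k) / ‖gramSchmidt ℝ f i‖ ^ 2) • gramSchmidt ℝ f i := by
    intro i
    simp only [gramSchmidtNormed, inner_smul_left, smul_smul]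
    congr 1
    simp
    ring
  have hk1 : k + 1 ≤ M := hk
  rw [← Finset.sum_subset (Finset.range_mono hk1), Finset.sum_range_succ]
  · have hself : inner ℝ (gramSchmidt ℝ f k) (f k) = ‖gramSchmidt ℝ f k‖ ^ 2 := by
      conv_lhs => rw [gramSchmidt_def'' ℝ f k]
      rw [inner_add_right, inner_sum, Finset.sum_eq_zero, add_zero, real_inner_self_eq_norm_sq]
      intro i hi
      rw [inner_smul_right, gramSchmidt_orthogonal ℝ f (Finset.mem_Iio.1 hi).ne', mul_zero]
    have hlast : (inner ℝ (gramSchmidt ℝ f k) (f k) / ‖gramSchmidt ℝ f k‖ ^ 2)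
        • gramSchmidt ℝ f k = gramSchmidt ℝ f k := by
      by_cases h0 : gramSchmidt ℝ f k = 0
      · simp [h0]
      · rw [hself, div_self (by simpa using h0), one_smul]
    simp only [hterm]
    rw [hlast, add_comm]
    conv_lhs => rw [gramSchmidt_def'' ℝ f k]
    rw [Nat.Iio_eq_range]
    rfl
  · intro i _ hi
    have : k < i := by simpa [Nat.lt_succ_iff] using hi
    rw [hterm, gramSchmidt_inv_triangular ℝ f this]
    simp

open InnerProductSpace in
/-- Every sequence in a real inner product space is the covariance structure of a centred Gaussian
sequence. -/
theorem exists_gaussian_sequence {H : Type*} [NormedAddCommGroup H] [InnerProductSpace ℝ H]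
    (f : ℕ → H) : ∃ ρ : Measure (ℕ → ℝ), IsProbabilityMeasure ρ ∧ ∀ (s : Finset ℕ) (c : ℕ → ℝ),
      HasLaw (fun x : ℕ → ℝ => ∑ k ∈ s, c k * x k)
        (gaussianReal 0 (‖∑ k ∈ s, c k • f k‖ ^ 2).toNNReal) ρ := by
  set e := gramSchmidtNormed ℝ f
  -- Replacing the Gram-Schmidt vectors `e i` by i.i.d. standard normals `x i` turns `f k` into a
  -- Gaussian variable with the same covariance structure.
  set G : (ℕ → ℝ) → ℕ → ℝ := fun x k => ∑ i ∈ Finset.range (k + 1), inner ℝ (e i) (f k) * x i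
  have hG : Measurable G := by
    refine measurable_pi_lambda _ fun k => ?_
    fun_prop
  refine ⟨(Measure.infinitePi (fun _ : ℕ => gaussianReal 0 1)).map G,
    Measure.isProbabilityMeasure_map hG.aemeasurable, fun s c => ?_⟩
  obtain ⟨M, hM⟩ : ∃ M, ∀ k ∈ s, k < M := ⟨s.sup id + 1, fun k hk =>
    Nat.lt_succ_of_le (Finset.le_sup (f := id) hk)⟩
  set F := ∑ k ∈ s, c k • f k with hF
  have hFexp : F = ∑ i ∈ Finset.range M, inner ℝ (e i) F • e i := by
    rw [hF]
    simp only [inner_sum, Finset.sum_smul]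
    rw [Finset.sum_comm]
    refine Finset.sum_congr rfl fun k hk => ?_
    conv_lhs => rw [eq_sum_inner_gramSchmidtNormed f (hM k hk), Finset.smul_sum]
    refine Finset.sum_congr rfl fun i _ => ?_
    rw [inner_smul_right, smul_smul]
  -- Only one of the two slots of the inner product is expanded, so orthonormality is not needed and
  -- vanishing `e i` do no harm.
  have hnorm : ‖F‖ ^ 2 = ∑ i ∈ Finset.range M, inner ℝ (e i) F ^ 2 := by
    rw [← real_inner_self_eq_norm_sq]
    conv_lhs => rw [hFexp, sum_inner]
    rw [← hFexp]
    refine Finset.sum_congr rfl fun i _ => ?_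
    rw [inner_smul_left, sq]
    rfl
  have hcomp : (fun x : ℕ → ℝ => ∑ k ∈ s, c k * x k) ∘ G
      = fun x => ∑ i ∈ Finset.range M, inner ℝ (e i) F * x i := by
    ext x
    simp only [Function.comp, G, hF, inner_sum, Finset.sum_mul, inner_smul_right]
    rw [Finset.sum_comm]
    refine Finset.sum_congr rfl fun k hk => ?_
    rw [Finset.mul_sum, ← Finset.sum_subset (Finset.range_mono (hM k hk : k + 1 ≤ M))]
    · exact Finset.sum_congr rfl fun i _ => by ring
    · intro i _ hi
      have : k < i := by simpa [Nat.lt_succ_iff] using hi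
      have h0 : inner ℝ (e i) (f k) = 0 := by
        simp only [e, gramSchmidtNormed, inner_smul_left, gramSchmidt_inv_triangular ℝ f this,
          mul_zero]
      rw [h0]; ring
  refine ⟨Measurable.aemeasurable (by fun_prop), ?_⟩
  rw [Measure.map_map (by fun_prop) hG, hcomp, hnorm]
  exact (hasLaw_sum_infinitePi_gaussianReal _ _).map_eq

end GaussianLimits

/-! ### Growth of sums of regularly varying covariances over squares and rectangles. -/

section Asymptotics

/-- The increments of `k ↦ k ^ p` are asymptotic to `p * k ^ (p - 1)`. -/
theorem tendsto_rpow_succ_sub_div {p : ℝ} :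
    Tendsto (fun k : ℕ => (((k : ℝ) + 1) ^ p - (k : ℝ) ^ p) / (k : ℝ) ^ (p - 1)) atTop (𝓝 p) := by
  -- After division by `k ^ p` the increment is the difference quotient of `x ^ p` at `1` with step
  -- `1 / k`.
  have hd : HasDerivAt (fun x : ℝ => x ^ p) p 1 := by
    simpa using Real.hasDerivAt_rpow_const (x := 1) (p := p) (Or.inl one_ne_zero)
  have h1 := hasDerivAt_iff_tendsto_slope_zero.1 hd
  have h2 : Tendsto (fun k : ℕ => ((k : ℝ))⁻¹) atTop (𝓝[≠] 0) := by
    refine tendsto_nhdsWithin_iff.2 ⟨tendsto_inv_atTop_nhds_zero_nat, ?_⟩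
    filter_upwards [eventually_gt_atTop 0] with k hk
    simp [hk.ne']
  refine (h1.comp h2).congr' ?_
  filter_upwards [eventually_gt_atTop 0] with k hk
  have hk' : (0 : ℝ) < k := by exact_mod_cast hk
  have e1 : (1 + (k : ℝ)⁻¹) ^ p = ((k : ℝ) + 1) ^ p / (k : ℝ) ^ p := by
    rw [← Real.div_rpow (by positivity) hk'.le]
    congr 1
    field_simp
  simp only [Function.comp, inv_inv, Real.one_rpow, smul_eq_mul, e1]
  rw [Real.rpow_sub hk', Real.rpow_one]
  have : (k : ℝ) ^ p ≠ 0 := (Real.rpow_pos_of_pos hk' p).ne'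
  field_simp

/-- Summation of regularly varying sequences. -/
theorem tendsto_sum_range_div_rpow {p c : ℝ} (hp : 0 < p) {a : ℕ → ℝ}
    (ha : Tendsto (fun k : ℕ => a k / (k : ℝ) ^ (p - 1)) atTop (𝓝 c)) :
    Tendsto (fun m : ℕ => (∑ k ∈ Finset.range m, a k) / (m : ℝ) ^ p) atTop (𝓝 (c / p)) := by
  -- Stolz-Cesàro: `a` is compared with the telescoping increments `g`, whose sums are exactly `m ^
  -- p`. As `g` is positive with divergent sum, `a - (c / p) * g = o(g)` survives summation.
  set g : ℕ → ℝ := fun k => ((k : ℝ) + 1) ^ p - (k : ℝ) ^ p with hg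
  have hgpos : ∀ k, 0 < g k := fun k =>
    sub_pos.2 (Real.rpow_lt_rpow (by positivity) (by linarith) hp)
  have hgsum : ∀ m, ∑ k ∈ Finset.range m, g k = (m : ℝ) ^ p := by
    intro m
    have := Finset.sum_range_sub (fun k : ℕ => (k : ℝ) ^ p) m
    simpa [hg, Real.zero_rpow hp.ne'] using this
  have hlim : Tendsto (fun m : ℕ => (m : ℝ) ^ p) atTop atTop :=
    (tendsto_rpow_atTop hp).comp tendsto_natCast_atTop_atTop
  have hratio : Tendsto (fun k => a k / g k) atTop (𝓝 (c / p)) := by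
    refine (ha.div tendsto_rpow_succ_sub_div hp.ne').congr' ?_
    filter_upwards [eventually_gt_atTop 0] with k hk
    have : (k : ℝ) ^ (p - 1) ≠ 0 := (Real.rpow_pos_of_pos (by exact_mod_cast hk) _).ne'
    have := (hgpos k).ne'
    simp only [Pi.div_apply]
    rw [div_div_div_cancel_right₀ ‹_›]
  have ho : (fun k => a k - c / p * g k) =o[atTop] g := by
    refine (Asymptotics.isLittleO_iff_tendsto fun k hk => absurd hk (hgpos k).ne').2 ?_
    have := hratio.sub_const (c / p)
    rw [sub_self] at this
    refine this.congr fun k => ?_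
    have := (hgpos k).ne'
    field_simp
  have ho2 := ho.sum_range (fun k => (hgpos k).le) (by simpa only [hgsum] using hlim)
  simp only [Finset.sum_sub_distrib, ← Finset.mul_sum, hgsum] at ho2
  have h3 := ho2.tendsto_div_nhds_zero.add_const (c / p)
  rw [zero_add] at h3
  refine h3.congr' ?_
  filter_upwards [eventually_gt_atTop 0] with m hm
  have : (m : ℝ) ^ p ≠ 0 := (Real.rpow_pos_of_pos (by exact_mod_cast hm) _).ne'
  field_simp
  ring

/-- The sum of the covariances `r |k - l|` over a square. -/
noncomputable def squareSum (r : ℕ → ℝ) (m : ℕ) : ℝ :=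
  ∑ k ∈ Finset.range m, ∑ l ∈ Finset.range m, r (Nat.dist k l)

/-- Enlarging the square adds two equal arms and a corner. The doubled sum counts the corner `r 0`
twice, hence the subtraction. -/
theorem squareSum_succ (r : ℕ → ℝ) (m : ℕ) :
    squareSum r (m + 1) = squareSum r m + (2 * ∑ k ∈ Finset.range (m + 1), r k - r 0) := by
  have h1 : ∑ l ∈ Finset.range m, r (Nat.dist m l) = ∑ k ∈ Finset.range m, r (k + 1) := by
    rw [← Finset.sum_range_reflect (fun k => r (k + 1)) m]
    refine Finset.sum_congr rfl fun l hl => ?_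
    have := Finset.mem_range.1 hl
    congr 1
    rw [Nat.dist_eq_sub_of_le_right this.le]
    omega
  have h2 : ∑ k ∈ Finset.range m, r (Nat.dist k m) = ∑ k ∈ Finset.range m, r (k + 1) := by
    rw [← h1]
    exact Finset.sum_congr rfl fun l _ => by rw [Nat.dist_comm]
  simp only [squareSum, Finset.sum_range_succ, Finset.sum_add_distrib]
  rw [h1, h2, Nat.dist_self]
  have h3 := Finset.sum_range_succ r m
  rw [Finset.sum_range_succ'] at h3
  linarith

theorem squareSum_zero (r : ℕ → ℝ) : squareSum r 0 = 0 := by simp [squareSum]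

/-- The square of side `a + d` splits into squares of sides `a` and `d` and two equal cross blocks,
while the rectangle is the square of side `a` with one cross block. This is the discrete form of the
fractional Brownian covariance. -/
theorem sum_rectangle_eq_of_le (r : ℕ → ℝ) (a d : ℕ) :
    ∑ k ∈ Finset.range a, ∑ l ∈ Finset.range (a + d), r (Nat.dist k l)
      = (squareSum r a + squareSum r (a + d) - squareSum r d) / 2 := by
  have hs : ∀ f : ℕ → ℝ, ∑ l ∈ Finset.range (a + d), f l
      = ∑ l ∈ Finset.range a, f l + ∑ l ∈ Finset.range d, f (a + l) :=
    fun f => Finset.sum_range_add f a d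
  have hcross : ∑ k ∈ Finset.range d, ∑ l ∈ Finset.range a, r (Nat.dist (a + k) l)
      = ∑ k ∈ Finset.range a, ∑ l ∈ Finset.range d, r (Nat.dist k (a + l)) := by
    rw [Finset.sum_comm]
    exact Finset.sum_congr rfl fun k _ => Finset.sum_congr rfl fun l _ => by rw [Nat.dist_comm]
  have hd : ∑ k ∈ Finset.range d, ∑ l ∈ Finset.range d, r (Nat.dist (a + k) (a + l))
      = squareSum r d := by
    simp only [squareSum, Nat.dist_add_add_left]
  have hV : squareSum r (a + d) = squareSum r a
      + 2 * ∑ k ∈ Finset.range a, ∑ l ∈ Finset.range d, r (Nat.dist k (a + l))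
      + squareSum r d := by
    rw [squareSum, hs]
    simp only [hs, Finset.sum_add_distrib]
    rw [hcross, hd, ← squareSum]
    ring
  simp only [hs, Finset.sum_add_distrib]
  rw [hV, ← squareSum]
  ring

theorem sum_rectangle_eq (r : ℕ → ℝ) (a b : ℕ) :
    ∑ k ∈ Finset.range a, ∑ l ∈ Finset.range b, r (Nat.dist k l)
      = (squareSum r a + squareSum r b - squareSum r (Nat.dist a b)) / 2 := by
  rcases le_total a b with h | h
  · obtain ⟨d, rfl⟩ := Nat.exists_eq_add_of_le h
    rw [sum_rectangle_eq_of_le, Nat.dist_eq_sub_of_le h, Nat.add_sub_cancel_left]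
  · obtain ⟨d, rfl⟩ := Nat.exists_eq_add_of_le h
    rw [Finset.sum_comm, Nat.dist_eq_sub_of_le_right h, Nat.add_sub_cancel_left,
      add_comm (squareSum r (b + d)), ← sum_rectangle_eq_of_le]
    exact Finset.sum_congr rfl fun k _ => Finset.sum_congr rfl fun l _ => by rw [Nat.dist_comm]

/-- Summing twice: the sums of `r` grow like `c / (1 - β) * m ^ (1 - β)`, and by `squareSum_succ`
twice these are the increments of `squareSum r`, up to lower order. The two summations produce the
factors `1 - β` and `2 - β`. -/
theorem tendsto_squareSum_div {β c : ℝ} (hβ : β ∈ Set.Ioo (0 : ℝ) 1) {r : ℕ → ℝ}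
    (hr : Tendsto (fun m : ℕ => (m : ℝ) ^ β * r m) atTop (𝓝 c)) :
    Tendsto (fun m : ℕ => squareSum r m / (m : ℝ) ^ (2 - β)) atTop
      (𝓝 (2 * c / ((1 - β) * (2 - β)))) := by
  have h0 : (0 : ℝ) < 1 - β := by linarith [hβ.2]
  have hS := tendsto_sum_range_div_rpow (p := 1 - β) (c := c) h0 (a := r) (by
    refine hr.congr' ?_
    filter_upwards [eventually_gt_atTop 0] with k hk
    have hk' : (0 : ℝ) < k := by exact_mod_cast hk
    rw [show (1 - β - 1 : ℝ) = -β by ring, Real.rpow_neg hk'.le, div_inv_eq_mul, mul_comm])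
  -- The increment from `k` to `k + 1` contains the sum up to `r k` included; the extra term and the
  -- constant `r 0` are both negligible against `k ^ (1 - β)`.
  have hr1 : Tendsto (fun k : ℕ => r k / (k : ℝ) ^ (1 - β)) atTop (𝓝 0) := by
    have := hr.mul (tendsto_inv_atTop_nhds_zero_nat (𝕜 := ℝ))
    rw [mul_zero] at this
    refine this.congr' ?_
    filter_upwards [eventually_gt_atTop 0] with k hk
    have hk' : (0 : ℝ) < k := by exact_mod_cast hk
    have := (Real.rpow_pos_of_pos hk' β).ne'
    rw [Real.rpow_sub hk', Real.rpow_one]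
    field_simp
  have hc1 : Tendsto (fun k : ℕ => r 0 / (k : ℝ) ^ (1 - β)) atTop (𝓝 0) :=
    tendsto_const_nhds.div_atTop ((tendsto_rpow_atTop h0).comp tendsto_natCast_atTop_atTop)
  have hV : ∀ m, squareSum r m
      = ∑ k ∈ Finset.range m, (2 * ∑ i ∈ Finset.range (k + 1), r i - r 0) := by
    intro m
    induction m with
    | zero => simp [squareSum_zero]
    | succ m ih => rw [squareSum_succ, ih, eq_comm, Finset.sum_range_succ]
  have key := tendsto_sum_range_div_rpow (p := 2 - β) (c := 2 * (c / (1 - β)))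
    (by linarith [hβ.2]) (a := fun k => 2 * ∑ i ∈ Finset.range (k + 1), r i - r 0) (by
      have := ((hS.add hr1).const_mul 2).sub hc1
      simp only [add_zero, sub_zero] at this
      refine this.congr fun k => ?_
      rw [Finset.sum_range_succ, show (2 - β - 1 : ℝ) = 1 - β by ring]
      ring)
  simp only [hV]
  convert key using 2
  have : (2 - β : ℝ) ≠ 0 := by linarith [hβ.2]
  field_simp

theorem tendsto_squareSum_comp_div {p C t : ℝ} (hp : 0 < p) {r : ℕ → ℝ} (ht : 0 ≤ t)
    (hV : Tendsto (fun m : ℕ => squareSum r m / (m : ℝ) ^ p) atTop (𝓝 C))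
    {a : ℕ → ℕ} (ha : Tendsto (fun n : ℕ => (a n : ℝ) / n) atTop (𝓝 t)) :
    Tendsto (fun n : ℕ => (n : ℝ) ^ (-p) * squareSum r (a n)) atTop (𝓝 (C * t ^ p)) := by
  have hpow : Tendsto (fun n : ℕ => ((a n : ℝ) / n) ^ p) atTop (𝓝 (t ^ p)) :=
    ha.rpow_const (Or.inr hp.le)
  have heq : ∀ n : ℕ, squareSum r (a n) / (a n : ℝ) ^ p * ((a n : ℝ) / n) ^ p
      = (n : ℝ) ^ (-p) * squareSum r (a n) := by
    intro n
    rw [Real.div_rpow (by positivity) (by positivity), Real.rpow_neg (by positivity)]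
    rcases Nat.eq_zero_or_pos (a n) with h | h
    · simp [h, squareSum_zero]
    · have := (Real.rpow_pos_of_pos (show (0 : ℝ) < a n by exact_mod_cast h) p).ne'
      field_simp
  refine Tendsto.congr heq ?_
  rcases ht.eq_or_lt with rfl | ht
  -- For `t = 0` the side `a n` need not tend to infinity; boundedness of the ratio suffices, since
  -- the other factor vanishes.
  · obtain ⟨K, hK⟩ := hV.norm.bddAbove_range
    rw [Real.zero_rpow hp.ne'] at hpow ⊢
    rw [mul_zero]
    exact bdd_le_mul_tendsto_zero' K (.of_forall fun n => hK ⟨a n, rfl⟩) hpow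
  · refine Tendsto.mul (hV.comp ?_) hpow
    have : Tendsto (fun n : ℕ => (a n : ℝ)) atTop atTop := by
      refine (ha.pos_mul_atTop ht (tendsto_natCast_atTop_atTop (R := ℝ))).congr' ?_
      filter_upwards [eventually_gt_atTop 0] with n hn
      have : (n : ℝ) ≠ 0 := by exact_mod_cast hn.ne'
      field_simp
    exact tendsto_natCast_atTop_iff.1 this

theorem tendsto_rpow_mul_sum_rectangle {β c : ℝ} (hβ : β ∈ Set.Ioo (0 : ℝ) 1) {r : ℕ → ℝ}
    (hr : Tendsto (fun m : ℕ => (m : ℝ) ^ β * r m) atTop (𝓝 c)) (s t : ℝ≥0) :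
    Tendsto (fun n : ℕ => (n : ℝ) ^ (-(2 - β)) * ∑ k ∈ Finset.range ⌊(n : ℝ) * s⌋₊,
        ∑ l ∈ Finset.range ⌊(n : ℝ) * t⌋₊, r (Nat.dist k l)) atTop
      (𝓝 (2 * c / ((1 - β) * (2 - β))
        * (((s : ℝ) ^ (2 - β) + (t : ℝ) ^ (2 - β) - |(t : ℝ) - s| ^ (2 - β)) / 2))) := by
  have hV := tendsto_squareSum_div hβ hr
  have hp : 0 < 2 - β := by linarith [hβ.2]
  have hfl : ∀ t : ℝ≥0, Tendsto (fun n : ℕ => ((⌊(n : ℝ) * t⌋₊ : ℕ) : ℝ) / n) atTop (𝓝 (t : ℝ)) :=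
    fun t => by
      have := (tendsto_nat_floor_mul_div_atTop (R := ℝ) t.2).comp tendsto_natCast_atTop_atTop
      refine this.congr fun n => ?_
      simp [mul_comm]
  have hdist : Tendsto (fun n : ℕ =>
      ((Nat.dist ⌊(n : ℝ) * s⌋₊ ⌊(n : ℝ) * t⌋₊ : ℕ) : ℝ) / n) atTop (𝓝 |(t : ℝ) - s|) := by
    refine ((hfl t).sub (hfl s)).abs.congr fun n => ?_
    rw [← sub_div, abs_div, Nat.abs_cast]
    congr 1
    rcases le_total ⌊(n : ℝ) * s⌋₊ ⌊(n : ℝ) * t⌋₊ with h | h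
    · rw [Nat.dist_eq_sub_of_le h, Nat.cast_sub h, abs_of_nonneg]
      exact sub_nonneg.2 (by exact_mod_cast h)
    · rw [Nat.dist_eq_sub_of_le_right h, Nat.cast_sub h, abs_of_nonpos, neg_sub]
      exact sub_nonpos.2 (by exact_mod_cast h)
  have h1 := tendsto_squareSum_comp_div hp s.2 hV (hfl s)
  have h2 := tendsto_squareSum_comp_div hp t.2 hV (hfl t)
  have h3 := tendsto_squareSum_comp_div hp (abs_nonneg _) hV hdist
  convert ((h1.add h2).sub h3).div_const 2 using 2
  · rw [sum_rectangle_eq]; ring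
  · simp only [NNReal.val_eq_coe]; ring

end Asymptotics

/-! ### Moments of a density with a power singularity at `1`. -/

section DensityMoments

theorem integrableOn_one_sub_rpow {β : ℝ} (hβ : 0 < β) :
    IntegrableOn (fun x : ℝ => (1 - x) ^ (β - 1)) (Set.Ioo 0 1) := by
  have h := (intervalIntegral.intervalIntegrable_rpow' (a := 0) (b := 1)
    (r := β - 1) (by linarith)).comp_sub_left 1
  simp only [sub_zero, sub_self] at h
  exact ((intervalIntegrable_iff_integrableOn_Ioo_of_le zero_le_one).1 h.symm)

theorem integrableOn_pow_mul {f : ℝ → ℝ} (hf : IntegrableOn f (Set.Ioo 0 1)) (m : ℕ) :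
    IntegrableOn (fun x : ℝ => x ^ m * f x) (Set.Ioo 0 1) := by
  refine Integrable.bdd_mul (c := 1) hf (by fun_prop) ?_
  filter_upwards [ae_restrict_mem measurableSet_Ioo] with x hx
  rw [norm_pow, Real.norm_of_nonneg hx.1.le]
  exact pow_le_one₀ hx.1.le hx.2.le

/-- The integral is the Beta value `B(β, m + 1)`, and `m ^ β * B(β, m + 1)` is Euler's sequence
`Complex.GammaSeq`, which converges to the Gamma function. -/
theorem tendsto_rpow_mul_integral_pow_mul_one_sub_rpow {β : ℝ} (hβ : 0 < β) :
    Tendsto (fun m : ℕ => (m : ℝ) ^ β * ∫ x in Set.Ioo (0 : ℝ) 1, x ^ m * (1 - x) ^ (β - 1))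
      atTop (𝓝 (Real.Gamma β)) := by
  have h := Complex.GammaSeq_tendsto_Gamma β
  have hre : 0 < (β : ℂ).re := by simpa using hβ
  rw [Complex.Gamma_ofReal] at h
  have h2 := (Complex.continuous_re.tendsto _).comp h
  rw [Complex.ofReal_re] at h2
  refine h2.congr fun m => ?_
  have hb : Complex.betaIntegral β (m + 1)
      = ((∫ x in Set.Ioo (0 : ℝ) 1, x ^ m * (1 - x) ^ (β - 1) : ℝ) : ℂ) := by
    rw [Complex.betaIntegral_symm, Complex.betaIntegral, ← integral_Ioc_eq_integral_Ioo,
      ← intervalIntegral.integral_of_le zero_le_one, ← intervalIntegral.integral_ofReal]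
    refine intervalIntegral.integral_congr_ae (.of_forall fun x hx => ?_)
    rw [Set.uIoc_of_le zero_le_one] at hx
    have h1 : (0 : ℝ) ≤ 1 - x := by linarith [hx.2]
    push_cast
    rw [Complex.ofReal_cpow h1]
    push_cast
    congr 1
    rw [show ((m : ℂ) + 1 - 1) = (m : ℂ) by ring, Complex.cpow_natCast]
  simp only [Function.comp]
  rw [Complex.GammaSeq_eq_betaIntegral_of_re_pos hre, hb, ← Complex.ofReal_natCast,
    ← Complex.ofReal_cpow (by positivity), ← Complex.ofReal_mul, Complex.ofReal_re]

theorem tendsto_rpow_mul_pow {β q : ℝ} (hβ : β ≤ 1) (hq0 : 0 ≤ q) (hq : q < 1) :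
    Tendsto (fun m : ℕ => (m : ℝ) ^ β * q ^ m) atTop (𝓝 0) := by
  have h := tendsto_pow_const_mul_const_pow_of_abs_lt_one 1 (r := q) (by rwa [abs_of_nonneg hq0])
  refine squeeze_zero' (.of_forall fun m => by positivity) ?_ h
  filter_upwards [eventually_gt_atTop 0] with m hm
  have hm' : (1 : ℝ) ≤ m := by exact_mod_cast hm
  gcongr
  simpa using Real.rpow_le_rpow_of_exponent_le hm' hβ

theorem exists_forall_Ioo_of_tendsto_left {ψ : ℝ → ℝ} {ψ₁ ε : ℝ}
    (hψ_lim : Tendsto ψ (𝓝[<] 1) (𝓝 ψ₁)) (hε : 0 < ε) :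
    ∃ q ∈ Set.Ioo (0 : ℝ) 1, ∀ x ∈ Set.Ioo q 1, |ψ x - ψ₁| < ε := by
  have h := (Metric.tendsto_nhds.1 hψ_lim) ε hε
  obtain ⟨l, hl, hl2⟩ := (mem_nhdsLT_iff_exists_Ioo_subset' (show (0 : ℝ) < 1 by norm_num)).1 h
  refine ⟨max l (1 / 2), ⟨by positivity, max_lt hl (by norm_num)⟩, fun x hx => ?_⟩
  have := hl2 ⟨(le_max_left _ _).trans_lt hx.1, hx.2⟩
  simpa [Real.dist_eq] using this

/-- Near `1` the function `ψ` is bounded and `(1 - x) ^ (β - 1)` is integrable; away from `1` the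
extra factor `1 / (1 - x)` is bounded by `1 / (1 - q)`. This gives the finite mean of `lam / (1 -
α)`. -/
theorem integrableOn_mul_one_sub_rpow_sub_one {β ψ₁ : ℝ} (hβ : β ∈ Set.Ioo (0 : ℝ) 1)
    {ψ : ℝ → ℝ} (hψ_meas : AEMeasurable ψ (volume.restrict (Set.Ioo (0 : ℝ) 1)))
    (hψ_nonneg : ∀ x ∈ Set.Ioo (0 : ℝ) 1, 0 ≤ ψ x)
    (hψ_lim : Tendsto ψ (𝓝[<] 1) (𝓝 ψ₁))
    (h_int : IntegrableOn (fun x => ψ x * (1 - x) ^ β) (Set.Ioo 0 1)) :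
    IntegrableOn (fun x => ψ x * (1 - x) ^ (β - 1)) (Set.Ioo 0 1) := by
  obtain ⟨q, hq, hqψ⟩ := exists_forall_Ioo_of_tendsto_left hψ_lim one_pos
  have hb : IntegrableOn (fun x => (|ψ₁| + 1) * (1 - x) ^ (β - 1)
      + (1 - q)⁻¹ * (ψ x * (1 - x) ^ β)) (Set.Ioo 0 1) :=
    ((integrableOn_one_sub_rpow hβ.1).const_mul _).add (h_int.const_mul _)
  refine Integrable.mono' hb ?_ ?_
  · exact (hψ_meas.mul (Measurable.aemeasurable (by fun_prop))).aestronglyMeasurable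
  · filter_upwards [ae_restrict_mem measurableSet_Ioo] with x hx
    have h1 : 0 < 1 - x := by linarith [hx.2]
    have h2 : 0 < (1 - x) ^ (β - 1) := Real.rpow_pos_of_pos h1 _
    have h3 : 0 ≤ ψ x * (1 - x) ^ β := mul_nonneg (hψ_nonneg x hx) (Real.rpow_nonneg h1.le _)
    have hq1 : 0 < (1 - q)⁻¹ := inv_pos.2 (by linarith [hq.2])
    rw [Real.norm_of_nonneg (mul_nonneg (hψ_nonneg x hx) h2.le)]
    by_cases hxq : q < x
    · have h4 := (abs_lt.1 (hqψ x ⟨hxq, hx.2⟩)).2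
      have h5 : ψ x ≤ |ψ₁| + 1 := by linarith [le_abs_self ψ₁]
      have := mul_le_mul_of_nonneg_right h5 h2.le
      have := mul_nonneg hq1.le h3
      linarith
    · have h6 : ψ x * (1 - x) ^ (β - 1) = (1 - x)⁻¹ * (ψ x * (1 - x) ^ β) := by
        rw [Real.rpow_sub h1, Real.rpow_one]; field_simp
      have h7 : (1 - x)⁻¹ ≤ (1 - q)⁻¹ := by
        apply inv_anti₀ <;> linarith [hq.2]
      rw [h6]
      have := mul_le_mul_of_nonneg_right h7 h3
      have : 0 ≤ (|ψ₁| + 1) * (1 - x) ^ (β - 1) := by positivity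
      linarith

/-- Abelian asymptotics of the moments of a density regularly varying at `1`. -/
theorem tendsto_rpow_mul_integral_pow_mul {β ψ₁ : ℝ} (hβ : β ∈ Set.Ioo (0 : ℝ) 1)
    {ψ : ℝ → ℝ} (hψ_lim : Tendsto ψ (𝓝[<] 1) (𝓝 ψ₁))
    (h_int : IntegrableOn (fun x => ψ x * (1 - x) ^ (β - 1)) (Set.Ioo 0 1)) :
    Tendsto (fun m : ℕ => (m : ℝ) ^ β *
        ∫ x in Set.Ioo (0 : ℝ) 1, x ^ m * (ψ x * (1 - x) ^ (β - 1)))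
      atTop (𝓝 (ψ₁ * Real.Gamma β)) := by
  set J : ℕ → ℝ := fun m => ∫ x in Set.Ioo (0 : ℝ) 1, x ^ m * (1 - x) ^ (β - 1)
  have hJ : Tendsto (fun m : ℕ => (m : ℝ) ^ β * J m) atTop (𝓝 (Real.Gamma β)) :=
    tendsto_rpow_mul_integral_pow_mul_one_sub_rpow hβ.1
  have hI := integrableOn_one_sub_rpow hβ.1
  -- The constant part `ψ₁` gives the Beta integral with the required limit; it remains to show that
  -- `f` contributes nothing at scale `m ^ (-β)`.
  set f : ℝ → ℝ := fun x => (ψ x - ψ₁) * (1 - x) ^ (β - 1)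
  have hf : IntegrableOn f (Set.Ioo 0 1) := by
    have := h_int.sub (hI.const_mul ψ₁)
    refine this.congr (.of_forall fun x => ?_)
    simp only [f, Pi.sub_apply]; ring
  have hdiff : ∀ m : ℕ, ∫ x in Set.Ioo (0 : ℝ) 1, x ^ m * (ψ x * (1 - x) ^ (β - 1))
      = ψ₁ * J m + ∫ x in Set.Ioo (0 : ℝ) 1, x ^ m * f x := by
    intro m
    simp only [J]
    rw [← integral_const_mul, ← integral_add ((integrableOn_pow_mul hI m).const_mul _)
      (integrableOn_pow_mul hf m)]
    refine integral_congr_ae (.of_forall fun x => ?_)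
    simp only [f]; ring
  have hsmall : Tendsto (fun m : ℕ => (m : ℝ) ^ β * ∫ x in Set.Ioo (0 : ℝ) 1, x ^ m * f x)
      atTop (𝓝 0) := by
    rw [Metric.tendsto_nhds]
    intro ε hε
    have hΓ : 0 < Real.Gamma β := Real.Gamma_pos_of_pos hβ.1
    -- This makes the part near `1` contribute `ε / 2` in the limit; the part below `q` decays like
    -- `q ^ m`.
    set η := ε / (2 * Real.Gamma β) with hη
    have hηpos : 0 < η := by positivity
    obtain ⟨q, hq, hqψ⟩ := exists_forall_Ioo_of_tendsto_left hψ_lim hηpos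
    set K := ∫ x in Set.Ioo (0 : ℝ) 1, |f x|
    have hbound : ∀ m : ℕ, |∫ x in Set.Ioo (0 : ℝ) 1, x ^ m * f x| ≤ η * J m + q ^ m * K := by
      intro m
      simp only [J, K]
      rw [← integral_const_mul, ← integral_const_mul,
        ← integral_add ((integrableOn_pow_mul hI m).const_mul _) (hf.abs.const_mul _)]
      refine (abs_integral_le_integral_abs).trans (integral_mono_ae (integrableOn_pow_mul hf m).abs
        (((integrableOn_pow_mul hI m).const_mul _).add (hf.abs.const_mul _)) ?_)
      filter_upwards [ae_restrict_mem measurableSet_Ioo] with x hx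
      have h1 : 0 < 1 - x := by linarith [hx.2]
      have h2 : 0 < (1 - x) ^ (β - 1) := Real.rpow_pos_of_pos h1 _
      have hxm : 0 ≤ x ^ m := pow_nonneg hx.1.le _
      have hqm : 0 ≤ q ^ m := pow_nonneg hq.1.le _
      rw [abs_mul, abs_of_nonneg hxm]
      by_cases hxq : q < x
      · have h3 := (hqψ x ⟨hxq, hx.2⟩).le
        have h4 : |f x| ≤ η * (1 - x) ^ (β - 1) := by
          simp only [f]
          rw [abs_mul, abs_of_pos h2]
          exact mul_le_mul_of_nonneg_right h3 h2.le
        have h5 := mul_le_mul_of_nonneg_left h4 hxm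
        have h6 := mul_nonneg hqm (abs_nonneg (f x))
        linarith
      · have h5 : x ^ m ≤ q ^ m := pow_le_pow_left₀ hx.1.le (not_lt.1 hxq) m
        have h6 := mul_le_mul_of_nonneg_right h5 (abs_nonneg (f x))
        have h7 : 0 ≤ η * (x ^ m * (1 - x) ^ (β - 1)) := by positivity
        linarith
    have hlim : Tendsto (fun m : ℕ => η * ((m : ℝ) ^ β * J m) + (m : ℝ) ^ β * q ^ m * K) atTop
        (𝓝 (η * Real.Gamma β + 0 * K)) :=
      (hJ.const_mul η).add ((tendsto_rpow_mul_pow hβ.2.le hq.1.le hq.2).mul_const K)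
    have hlt : η * Real.Gamma β + 0 * K < ε := by
      rw [hη, zero_mul, add_zero]
      field_simp
      linarith
    filter_upwards [hlim.eventually (gt_mem_nhds hlt)] with m hm
    rw [Real.dist_eq, sub_zero, abs_mul, abs_of_nonneg (by positivity)]
    refine lt_of_le_of_lt ?_ hm
    have := mul_le_mul_of_nonneg_left (hbound m) (show (0 : ℝ) ≤ (m : ℝ) ^ β by positivity)
    linarith
  have := (hJ.const_mul ψ₁).add hsmall
  rw [add_zero] at this
  refine this.congr fun m => ?_
  rw [hdiff]; ring

end DensityMoments

/-! ### Integrating out one input at a time from conditional independence. -/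

section InputLaw

noncomputable instance : DecidableEq InarIndex := Classical.decEq _

/-- Conditional independence, integrated over an event: the conditional law of one variable given
the parameter is also its conditional law given the parameter and finitely many other variables. -/
theorem measure_inter_eq_setLIntegral_of_condIndepGiven {Ω ι : Type*} [DecidableEq ι]
    [MeasurableSpace Ω] {P : Measure Ω} [IsProbabilityMeasure P] {α : Ω → ℝ} (hα : Measurable α)
    {Z : ι → Ω → ℕ} (hZ : ∀ i, Measurable (Z i)) (hci : CondIndepGiven (sigmaOf α) Z P)
    {i : ι} {l : ℕ} {p : ℝ → ℝ} (hp : Measurable p)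
    (hlaw : P⟦Z i ⁻¹' {l} | sigmaOf α⟧ =ᵐ[P] fun ω => p (α ω))
    {B : Set ℝ} (hB : MeasurableSet B) {s : Finset ι} (his : i ∉ s) (A : ι → Set ℕ) :
    P ((α ⁻¹' B ∩ ⋂ j ∈ s, Z j ⁻¹' A j) ∩ Z i ⁻¹' {l})
      = ∫⁻ ω in α ⁻¹' B ∩ ⋂ j ∈ s, Z j ⁻¹' A j, ENNReal.ofReal (p (α ω)) ∂P := by
  have hm : sigmaOf α ≤ ‹MeasurableSpace Ω› := hα.comap_le
  set C := ⋂ j ∈ s, Z j ⁻¹' A j with hC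
  have hCm : MeasurableSet C :=
    Finset.measurableSet_biInter _ fun j _ => hZ j (MeasurableSet.of_discrete)
  have hEm : MeasurableSet (Z i ⁻¹' {l}) := hZ i (MeasurableSet.of_discrete)
  have hBm : MeasurableSet[sigmaOf α] (α ⁻¹' B) := ⟨B, hB, rfl⟩
  have hpi : Integrable (fun ω => p (α ω)) P := integrable_condExp.congr hlaw
  have hp0 : 0 ≤ᵐ[P] fun ω => p (α ω) := by
    have h0 : 0 ≤ᵐ[P] P⟦Z i ⁻¹' {l} | sigmaOf α⟧ :=
      condExp_nonneg (.of_forall fun ω => Set.indicator_nonneg (fun _ _ => zero_le_one) ω)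
    filter_upwards [h0, hlaw] with ω h1 h2
    rw [← h2]; exact h1
  -- The product formula is used for `s` and for `insert i s`, with the set at `i` changed to `{l}`;
  -- the two differ by the single factor `p (α)`.
  have hprod : P⟦C ∩ Z i ⁻¹' {l} | sigmaOf α⟧ =ᵐ[P] P⟦C | sigmaOf α⟧ * fun ω => p (α ω) := by
    have h1 := hci (insert i s) (Function.update A i {l})
    have h2 := hci s A
    have e1 : ⋂ j ∈ insert i s, Z j ⁻¹' (Function.update A i {l} j) = C ∩ Z i ⁻¹' {l} := by
      rw [Finset.set_biInter_insert, Function.update_self, Set.inter_comm, hC]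
      congr 1
      refine Set.iInter₂_congr fun j hj => ?_
      rw [Function.update_of_ne (ne_of_mem_of_not_mem hj his)]
    have e2 : ∏ j ∈ insert i s, P⟦Z j ⁻¹' (Function.update A i {l} j) | sigmaOf α⟧
        = P⟦Z i ⁻¹' {l} | sigmaOf α⟧ * ∏ j ∈ s, P⟦Z j ⁻¹' A j | sigmaOf α⟧ := by
      rw [Finset.prod_insert his, Function.update_self]
      congr 1
      refine Finset.prod_congr rfl fun j hj => ?_
      rw [Function.update_of_ne (ne_of_mem_of_not_mem hj his)]
    rw [e1, e2] at h1
    filter_upwards [h1, h2, hlaw] with ω h1 h2 h3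
    rw [h1, Pi.mul_apply, Pi.mul_apply, h2, h3, mul_comm]
  have h_int : Integrable (C.indicator (fun _ => (1 : ℝ)) * fun ω => p (α ω)) P := by
    refine (hpi.indicator hCm).congr (.of_forall fun ω => ?_)
    by_cases h : ω ∈ C <;> simp [h]
  have hpull : P[C.indicator (fun _ => (1 : ℝ)) * (fun ω => p (α ω)) | sigmaOf α]
      =ᵐ[P] P⟦C | sigmaOf α⟧ * fun ω => p (α ω) := by
    refine condExp_mul_of_stronglyMeasurable_right ?_ h_int ((integrable_const _).indicator hCm)
    exact (hp.comp (comap_measurable α)).stronglyMeasurable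
  have hreal : ∫ ω in α ⁻¹' B, (C ∩ Z i ⁻¹' {l}).indicator (fun _ => (1 : ℝ)) ω ∂P
      = ∫ ω in α ⁻¹' B, (C.indicator (fun _ => (1 : ℝ)) * fun ω => p (α ω)) ω ∂P := by
    rw [← setIntegral_condExp hm ((integrable_const _).indicator (hCm.inter hEm)) hBm,
      ← setIntegral_condExp hm h_int hBm]
    refine setIntegral_congr_ae (hm _ hBm) ?_
    filter_upwards [hprod, hpull] with ω h1 h2 _
    rw [h1, h2]
  have hL : ∫ ω in α ⁻¹' B, (C ∩ Z i ⁻¹' {l}).indicator (fun _ => (1 : ℝ)) ω ∂P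
      = P.real ((α ⁻¹' B ∩ C) ∩ Z i ⁻¹' {l}) := by
    rw [integral_indicator (hCm.inter hEm), Measure.restrict_restrict (hCm.inter hEm)]
    simp only [integral_const, smul_eq_mul, mul_one, measureReal_def, Measure.restrict_apply_univ]
    congr 2
    ext ω; simp only [Set.mem_inter_iff]; tauto
  have hR : ∫ ω in α ⁻¹' B, (C.indicator (fun _ => (1 : ℝ)) * fun ω => p (α ω)) ω ∂P
      = ∫ ω in α ⁻¹' B ∩ C, p (α ω) ∂P := by
    have : (C.indicator (fun _ => (1 : ℝ)) * fun ω => p (α ω)) = C.indicator fun ω => p (α ω) := by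
      ext ω; by_cases h : ω ∈ C <;> simp [h]
    rw [this, integral_indicator hCm, Measure.restrict_restrict hCm, Set.inter_comm]
  rw [hL, hR] at hreal
  rw [← ofReal_integral_eq_lintegral_ofReal hpi.integrableOn (ae_restrict_of_ae hp0), ← hreal,
    measureReal_def, ENNReal.ofReal_toReal (measure_ne_top _ _)]

/-- Rectangles over square cylinders determine finite measures on `ℝ × (ι → ℕ)`. -/
theorem ext_of_prod_squareCylinders {ι : Type*} {μ ν : Measure (ℝ × (ι → ℕ))} [IsFiniteMeasure μ]
    (h : ∀ (B : Set ℝ) (s : Finset ι) (A : ι → Set ℕ), MeasurableSet B →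
      μ {y | y.1 ∈ B ∧ ∀ j ∈ s, y.2 j ∈ A j} = ν {y | y.1 ∈ B ∧ ∀ j ∈ s, y.2 j ∈ A j}) :
    μ = ν := by
  set C : Set (Set (ℝ × (ι → ℕ))) := Set.image2 (· ×ˢ ·) {s : Set ℝ | MeasurableSet s}
    (squareCylinders (fun _ : ι => {s : Set ℕ | MeasurableSet s}))
  have hu : μ Set.univ = ν Set.univ := by
    simpa using h Set.univ ∅ (fun _ => Set.univ) MeasurableSet.univ
  refine ext_of_generate_finite C ?_ ?_ ?_ hu
  · refine (generateFrom_eq_prod MeasurableSpace.generateFrom_measurableSet generateFrom_squareCylinders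
      isCountablySpanning_measurableSet ?_).symm
    refine ⟨fun _ => Set.univ, fun _ => ⟨∅, fun _ => Set.univ, by simp, by simp⟩, Set.iUnion_const _⟩
  · exact MeasurableSpace.isPiSystem_measurableSet.prod
      (isPiSystem_squareCylinders (fun _ => MeasurableSpace.isPiSystem_measurableSet) (by simp))
  · rintro _ ⟨B, hB, _, ⟨s, A, hA, rfl⟩, rfl⟩
    have e : B ×ˢ ((s : Set ι).pi A) = {y : ℝ × (ι → ℕ) | y.1 ∈ B ∧ ∀ j ∈ s, y.2 j ∈ A j} := by
      ext y; simp [Set.mem_pi]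
    simp only [e]
    exact h B s A hB

/-- Since `h` ignores coordinate `i`, it is a function of the family with that coordinate frozen.
The law of the frozen family on `{Z i = l}` agrees with its law under the density `p (α)`, as can be
checked on cylinders. -/
theorem setLIntegral_eq_of_condIndepGiven {Ω ι : Type*} [DecidableEq ι]
    [MeasurableSpace Ω] {P : Measure Ω} [IsProbabilityMeasure P] {α : Ω → ℝ} (hα : Measurable α)
    {Z : ι → Ω → ℕ} (hZ : ∀ i, Measurable (Z i)) (hci : CondIndepGiven (sigmaOf α) Z P)
    {i : ι} {l : ℕ} {p : ℝ → ℝ} (hp : Measurable p)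
    (hlaw : P⟦Z i ⁻¹' {l} | sigmaOf α⟧ =ᵐ[P] fun ω => p (α ω))
    {h : ℝ × (ι → ℕ) → ℝ≥0∞} (hh : Measurable h)
    (hinv : ∀ a z n, h (a, Function.update z i n) = h (a, z)) :
    ∫⁻ ω in Z i ⁻¹' {l}, h (α ω, fun j => Z j ω) ∂P
      = ∫⁻ ω, h (α ω, fun j => Z j ω) * ENNReal.ofReal (p (α ω)) ∂P := by
  set W : Ω → ℝ × (ι → ℕ) := fun ω => (α ω, Function.update (fun j => Z j ω) i 0) with hW
  have hWm : Measurable W := by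
    refine hα.prodMk (measurable_pi_lambda _ fun j => ?_)
    by_cases hj : j = i
    · subst hj; simp
    · simpa [Function.update_of_ne hj] using hZ j
  have hhW : ∀ ω, h (α ω, fun j => Z j ω) = h (W ω) := fun ω => (hinv _ _ _).symm
  have hqm : Measurable fun ω => ENNReal.ofReal (p (α ω)) := (hp.comp hα).ennreal_ofReal
  have hmap : (P.restrict (Z i ⁻¹' {l})).map W
      = (P.withDensity fun ω => ENNReal.ofReal (p (α ω))).map W := by
    refine ext_of_prod_squareCylinders fun B s A hB => ?_
    have hset : MeasurableSet {y : ℝ × (ι → ℕ) | y.1 ∈ B ∧ ∀ j ∈ s, y.2 j ∈ A j} := by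
      have : {y : ℝ × (ι → ℕ) | y.1 ∈ B ∧ ∀ j ∈ s, y.2 j ∈ A j}
          = B ×ˢ (⋂ j ∈ s, (fun z : ι → ℕ => z j) ⁻¹' A j) := by ext y; simp
      rw [this]
      exact hB.prod (Finset.measurableSet_biInter _ fun j _ =>
        measurable_pi_apply j MeasurableSet.of_discrete)
    rw [Measure.map_apply hWm hset, Measure.map_apply hWm hset,
      Measure.restrict_apply (hWm hset), withDensity_apply _ (hWm hset)]
    -- Coordinate `i` of `W` is constantly `0`, so a cylinder condition at `i` is either vacuous or
    -- never satisfied.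
    by_cases h0 : i ∈ s → 0 ∈ A i
    · have e : W ⁻¹' {y | y.1 ∈ B ∧ ∀ j ∈ s, y.2 j ∈ A j}
          = α ⁻¹' B ∩ ⋂ j ∈ s.erase i, Z j ⁻¹' A j := by
        ext ω
        simp only [hW, Set.mem_preimage, Set.mem_ofPred_eq, Set.mem_inter_iff, Set.mem_iInter,
          Finset.mem_erase]
        refine and_congr_right fun _ => ⟨fun H j hj => ?_, fun H j hj => ?_⟩
        · simpa [Function.update_of_ne hj.1] using H j hj.2
        · by_cases hji : j = i
          · subst hji; simpa using h0 hj
          · simpa [Function.update_of_ne hji] using H j ⟨hji, hj⟩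
      rw [e]
      exact measure_inter_eq_setLIntegral_of_condIndepGiven hα hZ hci hp hlaw hB
        (Finset.notMem_erase i s) A
    · push Not at h0
      have e : W ⁻¹' {y | y.1 ∈ B ∧ ∀ j ∈ s, y.2 j ∈ A j} = ∅ := by
        ext ω
        simp only [hW, Set.mem_preimage, Set.mem_ofPred_eq, Set.mem_empty_iff_false, iff_false,
          not_and]
        intro _ H
        exact h0.2 (by simpa using H i h0.1)
      simp [e]
  simp only [hhW]
  rw [← lintegral_map hh hWm, hmap, lintegral_map hh hWm]
  refine (lintegral_withDensity_eq_lintegral_mul _ hqm (hh.comp hWm)).trans ?_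
  exact lintegral_congr fun ω => by simp [mul_comm]

/-- The conditional mass functions of the inputs of an INAR process, given the thinning
parameter. -/
noncomputable def inarMass (lam : ℝ) : InarIndex → ℕ → ℝ → ℝ
  | .initial, l, x => lam ^ l / ((l ! : ℝ) * (1 - x) ^ l) * Real.exp (-(lam / (1 - x)))
  | .innovation _, l, _ => lam ^ l / (l ! : ℝ) * Real.exp (-lam)
  | .offspring _ _, l, x => if l = 0 then 1 - x else if l = 1 then x else 0

theorem measurable_inarMass (lam : ℝ) (i : InarIndex) (l : ℕ) : Measurable (inarMass lam i l) := by
  cases i with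
  | initial =>
    change Measurable fun x : ℝ =>
      lam ^ l / ((l ! : ℝ) * (1 - x) ^ l) * Real.exp (-(lam / (1 - x)))
    fun_prop
  | innovation k => exact measurable_const
  | offspring k i =>
    change Measurable fun x : ℝ => if l = 0 then 1 - x else if l = 1 then x else 0
    split_ifs <;> fun_prop

/-- The conditional expectation of `g` of an input, given the thinning parameter. -/
noncomputable def inarMean (lam : ℝ) (i : InarIndex) (g : ℕ → ℝ≥0∞) (x : ℝ) : ℝ≥0∞ :=
  ∑' l, g l * ENNReal.ofReal (inarMass lam i l x)

theorem measurable_inarMean (lam : ℝ) (i : InarIndex) (g : ℕ → ℝ≥0∞) :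
    Measurable (inarMean lam i g) :=
  Measurable.tsum fun l => ((measurable_inarMass lam i l).ennreal_ofReal).const_mul _

/-- A joint law of the thinning parameter and the inputs for which every input can be integrated
out against its conditional mass function, the other inputs and the parameter being fixed. -/
def IsInputLaw (lam : ℝ) (M : Measure (ℝ × (InarIndex → ℕ))) : Prop :=
  ∀ (i : InarIndex) (g : ℕ → ℝ≥0∞) (h : ℝ × (InarIndex → ℕ) → ℝ≥0∞), Measurable h →
    (∀ a z n, h (a, Function.update z i n) = h (a, z)) →
    ∫⁻ y, h y * g (y.2 i) ∂M = ∫⁻ y, h y * inarMean lam i g y.1 ∂M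

/-- Inputs are removed one by one; each leaves a function of the parameter, which is absorbed into
`f`. Hence the induction generalizes over `f`. -/
theorem IsInputLaw.lintegral_prod {lam : ℝ} {M : Measure (ℝ × (InarIndex → ℕ))}
    (hM : IsInputLaw lam M) (s : Finset InarIndex) (g : InarIndex → ℕ → ℝ≥0∞)
    {f : ℝ → ℝ≥0∞} (hf : Measurable f) :
    ∫⁻ y, f y.1 * ∏ j ∈ s, g j (y.2 j) ∂M
      = ∫⁻ y, f y.1 * ∏ j ∈ s, inarMean lam j (g j) y.1 ∂M := by
  induction s using Finset.induction_on generalizing f with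
  | empty => simp
  | insert i s his ih =>
    have h1 := hM i (g i) (fun y => f y.1 * ∏ j ∈ s, g j (y.2 j))
      ((hf.comp measurable_fst).mul (Finset.measurable_prod _ fun j _ =>
        (measurable_of_countable (g j)).comp ((measurable_pi_apply j).comp measurable_snd)))
      (fun a z n => by
        congr 1
        refine Finset.prod_congr rfl fun j hj => ?_
        simp only [Function.update_of_ne (ne_of_mem_of_not_mem hj his)])
    have h2 := ih (hf.mul (measurable_inarMean lam i (g i)))
    simp only [Finset.prod_insert his]
    calc _ = ∫⁻ y, f y.1 * (∏ j ∈ s, g j (y.2 j)) * g i (y.2 i) ∂M :=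
          lintegral_congr fun y => by ring
      _ = _ := h1
      _ = ∫⁻ y, (f * inarMean lam i (g i)) y.1 * ∏ j ∈ s, g j (y.2 j) ∂M :=
          lintegral_congr fun y => by simp only [Pi.mul_apply]; ring
      _ = _ := h2
      _ = _ := lintegral_congr fun y => by simp only [Pi.mul_apply]; ring

/-- The law of the parameter determines the joint law with the inputs. -/
theorem IsInputLaw.eq_of_map_fst_eq {lam : ℝ} {M M' : Measure (ℝ × (InarIndex → ℕ))}
    [IsFiniteMeasure M] (hM : IsInputLaw lam M) (hM' : IsInputLaw lam M')
    (h : M.map Prod.fst = M'.map Prod.fst) : M = M' := by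
  refine ext_of_prod_squareCylinders fun B s A hB => ?_
  have hset : MeasurableSet {y : ℝ × (InarIndex → ℕ) | y.1 ∈ B ∧ ∀ j ∈ s, y.2 j ∈ A j} := by
    have : {y : ℝ × (InarIndex → ℕ) | y.1 ∈ B ∧ ∀ j ∈ s, y.2 j ∈ A j}
        = B ×ˢ (⋂ j ∈ s, (fun z : InarIndex → ℕ => z j) ⁻¹' A j) := by ext y; simp
    rw [this]
    exact hB.prod (Finset.measurableSet_biInter _ fun j _ =>
      measurable_pi_apply j MeasurableSet.of_discrete)
  have hf : Measurable (B.indicator (fun _ => (1 : ℝ≥0∞))) := measurable_const.indicator hB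
  have key : ∀ M : Measure (ℝ × (InarIndex → ℕ)), IsInputLaw lam M →
      M {y | y.1 ∈ B ∧ ∀ j ∈ s, y.2 j ∈ A j}
        = ∫⁻ x, B.indicator (fun _ => 1) x *
            ∏ j ∈ s, inarMean lam j ((A j).indicator fun _ => 1) x ∂(M.map Prod.fst) := by
    intro M hM
    have hfm : Measurable fun x => B.indicator (fun _ => (1 : ℝ≥0∞)) x *
        ∏ j ∈ s, inarMean lam j ((A j).indicator fun _ => 1) x :=
      hf.mul (Finset.measurable_prod _ fun j _ => measurable_inarMean _ _ _)
    rw [lintegral_map hfm measurable_fst, ← hM.lintegral_prod s (fun j => (A j).indicator fun _ => 1) hf,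
      ← lintegral_indicator_one hset]
    refine lintegral_congr fun y => ?_
    have hy : y ∈ {y : ℝ × (InarIndex → ℕ) | y.1 ∈ B ∧ ∀ j ∈ s, y.2 j ∈ A j}
        ↔ y.1 ∈ B ∧ ∀ j ∈ s, y.2 j ∈ A j := Iff.rfl
    by_cases h1 : y.1 ∈ B
    · by_cases h2 : ∀ j ∈ s, y.2 j ∈ A j
      · rw [Set.indicator_of_mem (hy.2 ⟨h1, h2⟩), Set.indicator_of_mem h1, Finset.prod_eq_one]
        · simp
        · intro j hj; rw [Set.indicator_of_mem (h2 j hj)]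
      · rw [Set.indicator_of_notMem (fun H => h2 (hy.1 H).2)]
        push Not at h2
        obtain ⟨j, hj, hj2⟩ := h2
        rw [Finset.prod_eq_zero hj (Set.indicator_of_notMem hj2 _), mul_zero]
    · rw [Set.indicator_of_notMem (fun H => h1 (hy.1 H).1), Set.indicator_of_notMem h1, zero_mul]
  rw [key M hM, key M' hM', h]

end InputLaw

/-! ### The joint law of parameter and inputs, and the path as a function of the inputs. -/

section InarLaw

variable {Ω : Type*} [MeasurableSpace Ω] {P : Measure Ω} {lam : ℝ} {α : Ω → ℝ}
  {X : ℕ → Ω → ℕ} {ε : ℕ → Ω → ℕ} {ξ : ℕ → ℕ → Ω → ℕ}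

theorem IsRandomizedInar.measurable_input (h : IsRandomizedInar P lam α X ε ξ) (i : InarIndex) :
    Measurable (inarInput (X 0) ε ξ i) := by
  cases i with
  | initial => exact h.measurable_initial
  | innovation k => exact h.measurable_innovation k
  | offspring k i => exact h.measurable_offspring k i

theorem integral_condExp_preimage [IsProbabilityMeasure P] (hα : Measurable α) {Y : Ω → ℕ}
    (hY : Measurable Y) (l : ℕ) :
    ∫ ω, (P⟦Y ⁻¹' {l} | sigmaOf α⟧) ω ∂P = P.real (Y ⁻¹' {l}) := by
  rw [integral_condExp hα.comap_le]
  exact integral_indicator_one (hY MeasurableSet.of_discrete)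

/-- Integrated over the parameter, the masses at `0` and `1` are `1 - E α` and `E α`, which already
add up to `1`. -/
theorem IsRandomizedInar.offspring_le_one [IsProbabilityMeasure P]
    (h : IsRandomizedInar P lam α X ε ξ) (k i : ℕ) : ∀ᵐ ω ∂P, ξ k i ω = 0 ∨ ξ k i ω = 1 := by
  have hξ := h.measurable_offspring k i
  have h1 := integral_condExp_preimage (P := P) h.measurable_param hξ 1
  have h0 := integral_condExp_preimage (P := P) h.measurable_param hξ 0
  have hαi : Integrable α P := integrable_condExp.congr (h.offspring_one k i)
  rw [integral_congr_ae (h.offspring_one k i)] at h1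
  rw [integral_congr_ae (h.offspring_zero k i), integral_sub (integrable_const _) hαi, h1] at h0
  have hu : P.real (ξ k i ⁻¹' {0} ∪ ξ k i ⁻¹' {1}) = 1 := by
    rw [measureReal_union _ (hξ MeasurableSet.of_discrete), ← h0]
    · simp
    · exact Disjoint.preimage _ (by simp)
  have hm : MeasurableSet (ξ k i ⁻¹' {0} ∪ ξ k i ⁻¹' {1}) :=
    (hξ MeasurableSet.of_discrete).union (hξ MeasurableSet.of_discrete)
  have : P (ξ k i ⁻¹' {0} ∪ ξ k i ⁻¹' {1}) = 1 := by
    rw [measureReal_def] at hu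
    rwa [ENNReal.toReal_eq_one_iff] at hu
  have h2 := (prob_compl_eq_zero_iff hm).2 this
  filter_upwards [measure_eq_zero_iff_ae_notMem.1 h2] with ω hω
  exact not_not.1 hω

theorem IsRandomizedInar.input_law [IsProbabilityMeasure P]
    (h : IsRandomizedInar P lam α X ε ξ) (i : InarIndex) (l : ℕ) :
    P⟦inarInput (X 0) ε ξ i ⁻¹' {l} | sigmaOf α⟧ =ᵐ[P] fun ω => inarMass lam i l (α ω) := by
  cases i with
  | initial => exact h.initial_law l
  | innovation k => exact h.innovation_law k l
  | offspring k i =>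
    rcases l with _ | _ | l
    · exact h.offspring_zero k i
    · exact h.offspring_one k i
    · have : (inarInput (X 0) ε ξ (.offspring k i) ⁻¹' {l + 1 + 1}).indicator (fun _ => (1 : ℝ))
          =ᵐ[P] 0 := by
        filter_upwards [h.offspring_le_one k i] with ω hω
        refine Set.indicator_of_notMem ?_ _
        simp only [inarInput, Set.mem_preimage, Set.mem_singleton_iff]
        omega
      refine (condExp_congr_ae this).trans ?_
      rw [condExp_zero]
      refine .of_forall fun ω => ?_
      simp [inarMass]

/-- The joint law of the thinning parameter and the inputs. -/
noncomputable def inarLaw (P : Measure Ω) (α : Ω → ℝ) (X₀ : Ω → ℕ) (ε : ℕ → Ω → ℕ)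
    (ξ : ℕ → ℕ → Ω → ℕ) : Measure (ℝ × (InarIndex → ℕ)) :=
  P.map fun ω => (α ω, fun i => inarInput X₀ ε ξ i ω)

theorem IsRandomizedInar.measurable_pair (h : IsRandomizedInar P lam α X ε ξ) :
    Measurable fun ω => (α ω, fun i => inarInput (X 0) ε ξ i ω) :=
  h.measurable_param.prodMk (measurable_pi_lambda _ h.measurable_input)

/-- Split according to the value `l` of the input, exchange on each level set by
`setLIntegral_eq_of_condIndepGiven`, and sum. From here on the moment computations use only this
integral identity and no conditional expectations. -/
theorem IsRandomizedInar.isInputLaw [IsProbabilityMeasure P]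
    (h : IsRandomizedInar P lam α X ε ξ) : IsInputLaw lam (inarLaw P α (X 0) ε ξ) := by
  intro i g f hf hinv
  have hZ := h.measurable_input
  set Z := inarInput (X 0) ε ξ with hZdef
  have hg : Measurable fun y : ℝ × (InarIndex → ℕ) => f y * g (y.2 i) :=
    hf.mul ((measurable_of_countable g).comp ((measurable_pi_apply i).comp measurable_snd))
  have hg' : Measurable fun y : ℝ × (InarIndex → ℕ) => f y * inarMean lam i g y.1 :=
    hf.mul ((measurable_inarMean lam i g).comp measurable_fst)
  rw [inarLaw, lintegral_map hg h.measurable_pair, lintegral_map hg' h.measurable_pair]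
  have hfm : Measurable fun ω => f (α ω, fun j => Z j ω) := hf.comp h.measurable_pair
  have hEm : ∀ l, MeasurableSet (Z i ⁻¹' {l}) := fun l => hZ i MeasurableSet.of_discrete
  calc ∫⁻ ω, f (α ω, fun j => Z j ω) * g (Z i ω) ∂P
      = ∫⁻ ω, ∑' l, g l * (Z i ⁻¹' {l}).indicator (fun ω => f (α ω, fun j => Z j ω)) ω ∂P := by
        refine lintegral_congr fun ω => ?_
        rw [tsum_eq_single (Z i ω)]
        · rw [Set.indicator_of_mem (by simp), mul_comm]
        · intro l hl
          rw [Set.indicator_of_notMem (by simpa using hl.symm), mul_zero]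
    _ = ∑' l, g l * ∫⁻ ω in Z i ⁻¹' {l}, f (α ω, fun j => Z j ω) ∂P := by
        rw [lintegral_tsum fun l => ((hfm.indicator (hEm l)).const_mul _).aemeasurable]
        refine tsum_congr fun l => ?_
        rw [lintegral_const_mul _ (hfm.indicator (hEm l)), lintegral_indicator (hEm l)]
    _ = ∑' l, ∫⁻ ω, f (α ω, fun j => Z j ω) *
          (g l * ENNReal.ofReal (inarMass lam i l (α ω))) ∂P := by
        refine tsum_congr fun l => ?_
        have hpm : Measurable fun ω => ENNReal.ofReal (inarMass lam i l (α ω)) :=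
          ((measurable_inarMass lam i l).comp h.measurable_param).ennreal_ofReal
        rw [setLIntegral_eq_of_condIndepGiven h.measurable_param hZ h.condIndep
          (measurable_inarMass lam i l) (h.input_law i l) hf hinv,
          ← lintegral_const_mul (g l) (show Measurable fun ω => f (α ω, fun j => Z j ω) *
            ENNReal.ofReal (inarMass lam i l (α ω)) from hfm.mul hpm)]
        exact lintegral_congr fun ω => by ring
    _ = ∫⁻ ω, f (α ω, fun j => Z j ω) * inarMean lam i g (α ω) ∂P := by
        rw [← lintegral_tsum]
        · exact lintegral_congr fun ω => by rw [ENNReal.tsum_mul_left, inarMean]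
        · intro l
          exact (hfm.mul ((((measurable_inarMass lam i l).comp
            h.measurable_param).ennreal_ofReal).const_mul _)).aemeasurable

/-- The trajectory of an INAR process as a function of its inputs. -/
def inarPath (z : InarIndex → ℕ) : ℕ → ℕ
  | 0 => z .initial
  | k + 1 => ∑ i ∈ Finset.range (inarPath z k), z (.offspring k i) + z (.innovation k)

theorem IsRandomizedInar.eq_inarPath (h : IsRandomizedInar P lam α X ε ξ) (k : ℕ) (ω : Ω) :
    X k ω = inarPath (fun i => inarInput (X 0) ε ξ i ω) k := by
  induction k with
  | zero => rfl
  | succ k ih => rw [h.recursion, inarPath, ← ih]; rfl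

theorem measurable_inarPath (k : ℕ) : Measurable fun z => inarPath z k := by
  induction k with
  | zero => exact measurable_pi_apply _
  | succ k ih =>
    have h2 : Measurable fun p : ℕ × (InarIndex → ℕ) =>
        ∑ i ∈ Finset.range p.1, p.2 (.offspring k i) := by
      refine measurable_from_prod_countable_right fun n => ?_
      exact Finset.measurable_sum (Finset.range n) fun i _ =>
        measurable_pi_apply (InarIndex.offspring k i)
    exact (h2.comp (ih.prodMk measurable_id)).add (measurable_pi_apply _)

theorem map_fst_inarLaw (h : IsRandomizedInar P lam α X ε ξ) :
    (inarLaw P α (X 0) ε ξ).map Prod.fst = P.map α := by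
  rw [inarLaw, Measure.map_map measurable_fst h.measurable_pair]
  rfl

/-- Inputs with index `m` drive the step from `m` to `m + 1`, so the path is unaffected up to and
including time `m`. -/
theorem inarPath_update_offspring (z : InarIndex → ℕ) {k m : ℕ} (hk : k ≤ m) (i n : ℕ) :
    inarPath (Function.update z (.offspring m i) n) k = inarPath z k := by
  induction k with
  | zero => simp [inarPath]
  | succ k ih =>
    have hne : k ≠ m := by omega
    rw [inarPath, inarPath, ih (by omega)]
    simp [hne]

theorem inarPath_update_innovation (z : InarIndex → ℕ) {k m : ℕ} (hk : k ≤ m) (n : ℕ) :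
    inarPath (Function.update z (.innovation m) n) k = inarPath z k := by
  induction k with
  | zero => simp [inarPath]
  | succ k ih =>
    have hne : k ≠ m := by omega
    rw [inarPath, inarPath, ih (by omega)]
    simp [hne]

end InarLaw

/-! ### Conditional means and second factorial moments of the inputs. -/

section Means

theorem tsum_ofReal_poissonMass {θ : ℝ} (hθ : 0 ≤ θ) :
    ∑' l : ℕ, ENNReal.ofReal (θ ^ l / (l ! : ℝ) * Real.exp (-θ)) = 1 := by
  have h := (NormedSpace.expSeries_div_hasSum_exp θ).mul_right (Real.exp (-θ))
  rw [← Real.exp_eq_exp_ℝ, ← Real.exp_add, add_neg_cancel, Real.exp_zero] at h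
  rw [← ENNReal.ofReal_tsum_of_nonneg (fun l => by positivity) h.summable, h.tsum_eq,
    ENNReal.ofReal_one]

theorem tsum_mul_ofReal_poissonMass {θ : ℝ} (hθ : 0 ≤ θ) :
    ∑' l : ℕ, (l : ℝ≥0∞) * ENNReal.ofReal (θ ^ l / (l ! : ℝ) * Real.exp (-θ))
      = ENNReal.ofReal θ := by
  rw [tsum_eq_zero_add' ENNReal.summable]
  have : ∀ l : ℕ, ((l + 1 : ℕ) : ℝ≥0∞)
      * ENNReal.ofReal (θ ^ (l + 1) / ((l + 1)! : ℝ) * Real.exp (-θ))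
      = ENNReal.ofReal θ * ENNReal.ofReal (θ ^ l / (l ! : ℝ) * Real.exp (-θ)) := by
    intro l
    rw [← ENNReal.ofReal_natCast, ← ENNReal.ofReal_mul (by positivity), ← ENNReal.ofReal_mul hθ]
    congr 1
    rw [Nat.factorial_succ]
    push_cast
    field_simp
    ring
  simp only [this, ENNReal.tsum_mul_left, tsum_ofReal_poissonMass hθ]
  simp

/-- Factorial moments keep the recursion simple: the second one is `θ ^ 2` for a Poisson variable
and `0` for a Bernoulli variable. Truncated subtraction is harmless, as `l * (l - 1)` vanishes at `l
= 0`. -/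
theorem tsum_descFactorial_mul_ofReal_poissonMass {θ : ℝ} (hθ : 0 ≤ θ) :
    ∑' l : ℕ, ((l * (l - 1) : ℕ) : ℝ≥0∞) * ENNReal.ofReal (θ ^ l / (l ! : ℝ) * Real.exp (-θ))
      = ENNReal.ofReal θ ^ 2 := by
  rw [tsum_eq_zero_add' ENNReal.summable]
  have : ∀ l : ℕ, (((l + 1) * l : ℕ) : ℝ≥0∞)
      * ENNReal.ofReal (θ ^ (l + 1) / ((l + 1)! : ℝ) * Real.exp (-θ))
      = ENNReal.ofReal θ * ((l : ℝ≥0∞) * ENNReal.ofReal (θ ^ l / (l ! : ℝ) * Real.exp (-θ))) := by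
    intro l
    rw [← ENNReal.ofReal_natCast, ← ENNReal.ofReal_natCast, ← ENNReal.ofReal_mul (by positivity),
      ← ENNReal.ofReal_mul (by positivity), ← ENNReal.ofReal_mul hθ]
    congr 1
    rw [Nat.factorial_succ]
    push_cast
    field_simp
    ring
  simp only [Nat.add_sub_cancel, this, ENNReal.tsum_mul_left, tsum_mul_ofReal_poissonMass hθ]
  simp [sq]

variable {lam x : ℝ}

theorem inarMean_innovation_id (hlam : 0 ≤ lam) (k : ℕ) :
    inarMean lam (.innovation k) (fun l => (l : ℝ≥0∞)) x = ENNReal.ofReal lam :=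
  tsum_mul_ofReal_poissonMass hlam

theorem inarMean_innovation_descFactorial (hlam : 0 ≤ lam) (k : ℕ) :
    inarMean lam (.innovation k) (fun l => ((l * (l - 1) : ℕ) : ℝ≥0∞)) x
      = ENNReal.ofReal lam ^ 2 :=
  tsum_descFactorial_mul_ofReal_poissonMass hlam

theorem inarMass_initial (l : ℕ) :
    inarMass lam .initial l x
      = (lam / (1 - x)) ^ l / (l ! : ℝ) * Real.exp (-(lam / (1 - x))) := by
  simp only [inarMass, div_pow]
  rw [div_div, mul_comm ((1 - x) ^ l)]

theorem inarMean_initial_id (hlam : 0 ≤ lam) (hx : x ≤ 1) :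
    inarMean lam .initial (fun l => (l : ℝ≥0∞)) x = ENNReal.ofReal (lam / (1 - x)) := by
  simp only [inarMean, inarMass_initial]
  exact tsum_mul_ofReal_poissonMass (div_nonneg hlam (by linarith))

theorem inarMean_initial_descFactorial (hlam : 0 ≤ lam) (hx : x ≤ 1) :
    inarMean lam .initial (fun l => ((l * (l - 1) : ℕ) : ℝ≥0∞)) x
      = ENNReal.ofReal (lam / (1 - x)) ^ 2 := by
  simp only [inarMean, inarMass_initial]
  exact tsum_descFactorial_mul_ofReal_poissonMass (div_nonneg hlam (by linarith))

theorem inarMean_offspring_id (k i : ℕ) :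
    inarMean lam (.offspring k i) (fun l => (l : ℝ≥0∞)) x = ENNReal.ofReal x := by
  rw [inarMean, tsum_eq_single 1]
  · simp [inarMass]
  · rintro (_ | _ | l) hl <;> simp_all [inarMass]

theorem inarMean_offspring_descFactorial (k i : ℕ) :
    inarMean lam (.offspring k i) (fun l => ((l * (l - 1) : ℕ) : ℝ≥0∞)) x = 0 := by
  rw [inarMean, ENNReal.tsum_eq_zero]
  rintro (_ | _ | l) <;> simp [inarMass]

end Means

/-! ### One-step recursions for the moments of the path. -/

section Moments

/-- A nonnegative function of the parameter and of the inputs used before time `k`. -/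
structure IsInarPredictable (k : ℕ) (h : ℝ × (InarIndex → ℕ) → ℝ≥0∞) : Prop where
  measurable : Measurable h
  offspring : ∀ m, k ≤ m → ∀ i a z n, h (a, Function.update z (.offspring m i) n) = h (a, z)
  innovation : ∀ m, k ≤ m → ∀ a z n, h (a, Function.update z (.innovation m) n) = h (a, z)

namespace IsInarPredictable

variable {k : ℕ} {h h' : ℝ × (InarIndex → ℕ) → ℝ≥0∞}

theorem mul (hh : IsInarPredictable k h) (hh' : IsInarPredictable k h') :
    IsInarPredictable k (fun y => h y * h' y) where
  measurable := hh.measurable.mul hh'.measurable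
  offspring m hm i a z n := by rw [hh.offspring m hm, hh'.offspring m hm]
  innovation m hm a z n := by rw [hh.innovation m hm, hh'.innovation m hm]

theorem measurable_mul (hh : IsInarPredictable k h) (hh' : Measurable h') :
    Measurable fun y => h y * h' y :=
  hh.measurable.mul hh'

theorem of_fst {f : ℝ → ℝ≥0∞} (hf : Measurable f) (k : ℕ) :
    IsInarPredictable k (fun y => f y.1) where
  measurable := hf.comp measurable_fst
  offspring _ _ _ _ _ _ := rfl
  innovation _ _ _ _ _ := rfl

theorem of_path (w₀ : ℕ → ℝ≥0∞) {j k : ℕ} (hjk : j ≤ k) :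
    IsInarPredictable k (fun y => w₀ (inarPath y.2 j)) where
  measurable := (measurable_of_countable w₀).comp ((measurable_inarPath j).comp measurable_snd)
  offspring m hm i a z n := by
    simp only [inarPath_update_offspring z (hjk.trans hm)]
  innovation m hm a z n := by
    simp only [inarPath_update_innovation z (hjk.trans hm)]

end IsInarPredictable

variable {lam : ℝ} {M : Measure (ℝ × (InarIndex → ℕ))} {k : ℕ}
  {h : ℝ × (InarIndex → ℕ) → ℝ≥0∞}

theorem measurable_input_cast (w₀ : ℕ → ℝ≥0∞) (i : InarIndex) :
    Measurable fun y : ℝ × (InarIndex → ℕ) => w₀ (y.2 i) :=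
  (measurable_of_countable w₀).comp ((measurable_pi_apply i).comp measurable_snd)

theorem measurable_ofReal_fst :
    Measurable fun y : ℝ × (InarIndex → ℕ) => ENNReal.ofReal y.1 :=
  measurable_fst.ennreal_ofReal

theorem IsInputLaw.lintegral_offspring (hM : IsInputLaw lam M) (hh : IsInarPredictable k h) (i : ℕ) :
    ∫⁻ y, h y * (y.2 (.offspring k i) : ℝ≥0∞) ∂M = ∫⁻ y, h y * ENNReal.ofReal y.1 ∂M := by
  have := hM (.offspring k i) (fun l => (l : ℝ≥0∞)) h hh.measurable (hh.offspring k le_rfl i)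
  simpa only [inarMean_offspring_id] using this

/-- The variable with index `j` is integrated out first, the other being part of the test function;
then the remaining one, with the new factor `α` absorbed in the test function. -/
theorem IsInputLaw.lintegral_offspring_mul (hM : IsInputLaw lam M) (hh : IsInarPredictable k h)
    {i j : ℕ} (hij : i ≠ j) :
    ∫⁻ y, h y * ((y.2 (.offspring k i) : ℝ≥0∞) * (y.2 (.offspring k j) : ℝ≥0∞)) ∂M
      = ∫⁻ y, h y * ENNReal.ofReal y.1 ^ 2 ∂M := by
  have h1 := hM (.offspring k j) (fun l => (l : ℝ≥0∞))
    (fun y => h y * (y.2 (.offspring k i) : ℝ≥0∞))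
    (hh.measurable_mul (measurable_input_cast (fun l => (l : ℝ≥0∞)) _))
    (fun a z n => by
      rw [hh.offspring k le_rfl]
      simp [hij])
  have h2 := hM.lintegral_offspring (hh.mul (.of_fst ENNReal.measurable_ofReal k)) i
  simp only [inarMean_offspring_id] at h1
  calc _ = _ := lintegral_congr fun y => by ring
    _ = _ := h1
    _ = _ := lintegral_congr fun y => by ring
    _ = _ := h2
    _ = _ := lintegral_congr fun y => by ring

/-- The event that `j` is below the population at time `k` depends only on the past. Its indicator
joins the test function, and the sum over a random range becomes a series over all `j`. -/
theorem IsInputLaw.lintegral_sum_range_path {u v : ℕ → ℝ × (InarIndex → ℕ) → ℝ≥0∞}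
    (hu : ∀ j, Measurable (u j)) (hv : ∀ j, Measurable (v j))
    (huv : ∀ j h, IsInarPredictable k h → ∫⁻ y, h y * u j y ∂M = ∫⁻ y, h y * v j y ∂M)
    (hh : IsInarPredictable k h) :
    ∫⁻ y, h y * ∑ j ∈ Finset.range (inarPath y.2 k), u j y ∂M
      = ∫⁻ y, h y * ∑ j ∈ Finset.range (inarPath y.2 k), v j y ∂M := by
  set w₀ : ℕ → ℕ → ℝ≥0∞ := fun j n => if j < n then 1 else 0
  have hw₀ : ∀ j, IsInarPredictable k (fun y => h y * w₀ j (inarPath y.2 k)) := fun j =>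
    hh.mul (.of_path (w₀ j) le_rfl)
  have key : ∀ w : ℕ → ℝ × (InarIndex → ℕ) → ℝ≥0∞, (∀ j, Measurable (w j)) →
      ∫⁻ y, h y * ∑ j ∈ Finset.range (inarPath y.2 k), w j y ∂M
        = ∑' j, ∫⁻ y, h y * w₀ j (inarPath y.2 k) * w j y ∂M := by
    intro w hw
    rw [← lintegral_tsum fun j => ((hw₀ j).measurable_mul (hw j)).aemeasurable]
    refine lintegral_congr fun y => ?_
    rw [tsum_eq_sum (s := Finset.range (inarPath y.2 k)), Finset.mul_sum]
    · refine Finset.sum_congr rfl fun j hj => ?_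
      simp [w₀, Finset.mem_range.1 hj]
    · intro j hj
      simp [w₀, Finset.mem_range.not.1 hj]
  rw [key u hu, key v hv]
  exact tsum_congr fun j => huv j _ (hw₀ j)

theorem IsInputLaw.lintegral_path_succ (hlam : 0 ≤ lam) (hM : IsInputLaw lam M)
    (hh : IsInarPredictable k h) :
    ∫⁻ y, h y * (inarPath y.2 (k + 1) : ℝ≥0∞) ∂M
      = ∫⁻ y, h y * (ENNReal.ofReal y.1 * inarPath y.2 k + ENNReal.ofReal lam) ∂M := by
  have hξ : ∀ j, Measurable fun y : ℝ × (InarIndex → ℕ) => (y.2 (.offspring k j) : ℝ≥0∞) :=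
    fun j => measurable_input_cast (fun l => (l : ℝ≥0∞)) _
  have h1 := IsInputLaw.lintegral_sum_range_path (M := M) hξ
    (fun _ => measurable_ofReal_fst)
    (fun j h hh => hM.lintegral_offspring hh j) hh
  have h2 := hM (.innovation k) (fun l => (l : ℝ≥0∞)) h hh.measurable (hh.innovation k le_rfl)
  simp only [inarMean_innovation_id hlam] at h2
  simp only [Finset.sum_const, Finset.card_range, nsmul_eq_mul] at h1
  have hm : Measurable fun y : ℝ × (InarIndex → ℕ) => h y * (y.2 (.innovation k) : ℝ≥0∞) :=
    hh.measurable_mul (measurable_input_cast (fun l => (l : ℝ≥0∞)) _)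
  calc _ = ∫⁻ y, (h y * ∑ j ∈ Finset.range (inarPath y.2 k), (y.2 (.offspring k j) : ℝ≥0∞))
        + h y * (y.2 (.innovation k) : ℝ≥0∞) ∂M :=
        lintegral_congr fun y => by rw [inarPath]; push_cast; ring
    _ = _ := by rw [lintegral_add_right _ hm, h1, h2]
    _ = ∫⁻ y, (h y * ((inarPath y.2 k : ℝ≥0∞) * ENNReal.ofReal y.1))
        + h y * ENNReal.ofReal lam ∂M :=
        (lintegral_add_right _ (hh.measurable_mul measurable_const)).symm
    _ = _ := lintegral_congr fun y => by ring

theorem descFactorial_two_add (a b : ℕ) :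
    (a + b) * (a + b - 1) = a * (a - 1) + 2 * a * b + b * (b - 1) := by
  rcases a with _ | a
  · simp
  · rcases b with _ | b
    · simp
    · simp only [Nat.add_sub_cancel, show a + 1 + (b + 1) - 1 = a + b + 1 by omega]
      ring

theorem descFactorial_two_sum_range (x : ℕ → ℕ) (n : ℕ) :
    (∑ j ∈ Finset.range n, x j) * (∑ j ∈ Finset.range n, x j - 1)
      = ∑ j ∈ Finset.range n, (x j * (x j - 1) + 2 * ∑ i ∈ Finset.range j, x i * x j) := by
  induction n with
  | zero => simp
  | succ n ih =>
    rw [Finset.sum_range_succ, Finset.sum_range_succ, descFactorial_two_add, ih,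
      ← Finset.sum_mul]
    ring

theorem sum_range_two_mul_cast (n : ℕ) :
    ∑ j ∈ Finset.range n, 2 * (j : ℝ≥0∞) = ((n * (n - 1) : ℕ) : ℝ≥0∞) := by
  rw [← Finset.mul_sum, ← Finset.sum_range_id_mul_two, mul_comm]
  push_cast
  rfl

/-- With `S` the offspring total, the factorial square of `S + ε` is that of `S`, plus `2 * S * ε`,
plus that of `ε`. The Bernoulli diagonal terms vanish and each pair of distinct offspring
contributes `α ^ 2`. Working with `ℝ≥0∞` values avoids integrability conditions. -/
theorem IsInputLaw.lintegral_descFactorial_path_succ (hlam : 0 ≤ lam) (hM : IsInputLaw lam M)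
    (hh : IsInarPredictable k h) :
    ∫⁻ y, h y * ((inarPath y.2 (k + 1) * (inarPath y.2 (k + 1) - 1) : ℕ) : ℝ≥0∞) ∂M
      = ∫⁻ y, h y * (ENNReal.ofReal y.1 ^ 2 * ((inarPath y.2 k * (inarPath y.2 k - 1) : ℕ) : ℝ≥0∞)
          + 2 * ENNReal.ofReal lam * (ENNReal.ofReal y.1 * inarPath y.2 k)
          + ENNReal.ofReal lam ^ 2) ∂M := by
  have hξ : ∀ j, Measurable fun y : ℝ × (InarIndex → ℕ) => (y.2 (.offspring k j) : ℝ≥0∞) :=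
    fun j => measurable_input_cast (fun l => (l : ℝ≥0∞)) _
  have hξ2 : ∀ j, Measurable fun y : ℝ × (InarIndex → ℕ) =>
      ((y.2 (.offspring k j) * (y.2 (.offspring k j) - 1) : ℕ) : ℝ≥0∞) :=
    fun j => measurable_input_cast (fun l => ((l * (l - 1) : ℕ) : ℝ≥0∞)) _
  have hε : Measurable fun y : ℝ × (InarIndex → ℕ) => (y.2 (.innovation k) : ℝ≥0∞) :=
    measurable_input_cast (fun l => (l : ℝ≥0∞)) _
  have hε2 : Measurable fun y : ℝ × (InarIndex → ℕ) =>
      ((y.2 (.innovation k) * (y.2 (.innovation k) - 1) : ℕ) : ℝ≥0∞) :=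
    measurable_input_cast (fun l => ((l * (l - 1) : ℕ) : ℝ≥0∞)) _
  set S : ℝ × (InarIndex → ℕ) → ℝ≥0∞ := fun y =>
    ∑ j ∈ Finset.range (inarPath y.2 k), (y.2 (.offspring k j) : ℝ≥0∞) with hS
  -- The factorial square of the offspring total, with pairs grouped by their larger index.
  set T : ℝ × (InarIndex → ℕ) → ℝ≥0∞ := fun y => ∑ j ∈ Finset.range (inarPath y.2 k),
    (((y.2 (.offspring k j) * (y.2 (.offspring k j) - 1) : ℕ) : ℝ≥0∞)
      + 2 * ∑ i ∈ Finset.range j,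
        ((y.2 (.offspring k i) : ℝ≥0∞) * (y.2 (.offspring k j) : ℝ≥0∞))) with hT
  have hSm : Measurable S := by
    have : Measurable fun p : ℕ × (InarIndex → ℕ) =>
        ∑ j ∈ Finset.range p.1, (p.2 (.offspring k j) : ℝ≥0∞) := by
      refine measurable_from_prod_countable_right fun n => ?_
      exact Finset.measurable_sum (Finset.range n) fun j _ =>
        (measurable_of_countable (fun l : ℕ => (l : ℝ≥0∞))).comp
          (measurable_pi_apply (InarIndex.offspring k j))
    exact this.comp (((measurable_inarPath k).comp measurable_snd).prodMk measurable_snd)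
  have hexp : ∀ y : ℝ × (InarIndex → ℕ),
      ((inarPath y.2 (k + 1) * (inarPath y.2 (k + 1) - 1) : ℕ) : ℝ≥0∞)
        = T y + 2 * (S y * (y.2 (.innovation k) : ℝ≥0∞))
          + ((y.2 (.innovation k) * (y.2 (.innovation k) - 1) : ℕ) : ℝ≥0∞) := by
    intro y
    rw [inarPath, descFactorial_two_add, descFactorial_two_sum_range, Nat.cast_add, Nat.cast_add]
    congr 2
    · simp only [hT]; push_cast; rfl
    · simp only [hS]; push_cast; ring
  have hTm' : ∀ j, Measurable fun y : ℝ × (InarIndex → ℕ) =>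
      (((y.2 (.offspring k j) * (y.2 (.offspring k j) - 1) : ℕ) : ℝ≥0∞)
      + 2 * ∑ i ∈ Finset.range j,
        ((y.2 (.offspring k i) : ℝ≥0∞) * (y.2 (.offspring k j) : ℝ≥0∞))) := fun j =>
    (hξ2 j).add ((Finset.measurable_sum _ fun i _ => (hξ i).fun_mul (hξ j)).const_mul 2)
  have h1 : ∫⁻ y, h y * T y ∂M = ∫⁻ y, h y * (ENNReal.ofReal y.1 ^ 2 *
      ((inarPath y.2 k * (inarPath y.2 k - 1) : ℕ) : ℝ≥0∞)) ∂M := by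
    have := IsInputLaw.lintegral_sum_range_path (M := M) (k := k) hTm'
      -- The index `j` is the larger one in exactly `j` pairs, each counted twice.
      (v := fun j y => 2 * (j : ℝ≥0∞) * ENNReal.ofReal y.1 ^ 2)
      (fun j => (measurable_ofReal_fst.pow_const 2).const_mul _) ?_ hh
    · rw [hT, this]
      refine lintegral_congr fun y => ?_
      rw [← Finset.sum_mul, sum_range_two_mul_cast]
      ring
    · intro j h hh
      have e1 := hM (.offspring k j) (fun l => ((l * (l - 1) : ℕ) : ℝ≥0∞)) h hh.measurable
        (hh.offspring k le_rfl j)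
      simp only [inarMean_offspring_descFactorial, mul_zero, lintegral_zero] at e1
      simp only [mul_add]
      rw [lintegral_add_left (hh.measurable_mul (hξ2 j)), e1, zero_add]
      have e2 : ∀ i ∈ Finset.range j,
          ∫⁻ y, h y * ((y.2 (.offspring k i) : ℝ≥0∞) * (y.2 (.offspring k j) : ℝ≥0∞)) ∂M
            = ∫⁻ y, h y * ENNReal.ofReal y.1 ^ 2 ∂M := fun i hi =>
        hM.lintegral_offspring_mul hh (Finset.mem_range.1 hi).ne
      calc _ = ∫⁻ y, 2 * ∑ i ∈ Finset.range j,
            h y * ((y.2 (.offspring k i) : ℝ≥0∞) * (y.2 (.offspring k j) : ℝ≥0∞)) ∂M :=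
            lintegral_congr fun y => by rw [← Finset.mul_sum]; ring
        _ = 2 * ∑ i ∈ Finset.range j, ∫⁻ y,
            h y * ((y.2 (.offspring k i) : ℝ≥0∞) * (y.2 (.offspring k j) : ℝ≥0∞)) ∂M := by
            rw [lintegral_const_mul _ (Finset.measurable_sum _ fun i _ =>
              hh.measurable_mul ((hξ i).fun_mul (hξ j))),
              lintegral_finsetSum _ fun i _ => hh.measurable_mul ((hξ i).fun_mul (hξ j))]
        _ = 2 * (j : ℝ≥0∞) * ∫⁻ y, h y * ENNReal.ofReal y.1 ^ 2 ∂M := by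
            rw [Finset.sum_congr rfl e2, Finset.sum_const, Finset.card_range, nsmul_eq_mul]
            ring
        _ = _ := by
            rw [← lintegral_const_mul _ (hh.measurable_mul (measurable_ofReal_fst.pow_const 2))]
            exact lintegral_congr fun y => by ring
  have h2 : ∫⁻ y, h y * (2 * (S y * (y.2 (.innovation k) : ℝ≥0∞))) ∂M
      = ∫⁻ y, h y * (2 * ENNReal.ofReal lam * (ENNReal.ofReal y.1 * inarPath y.2 k)) ∂M := by
    have e1 := hM (.innovation k) (fun l => (l : ℝ≥0∞)) (fun y => h y * (2 * S y))
      (hh.measurable_mul (hSm.const_mul 2)) (fun a z n => by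
        rw [hh.innovation k le_rfl]
        simp only [hS, inarPath_update_innovation z le_rfl]
        simp)
    have hc : IsInarPredictable k fun y => h y * (2 * ENNReal.ofReal lam) :=
      hh.mul (.of_fst measurable_const k)
    have e2 := IsInputLaw.lintegral_sum_range_path (M := M) hξ
      (fun _ => measurable_ofReal_fst)
      (fun j h hh => hM.lintegral_offspring hh j) hc
    simp only [Finset.sum_const, Finset.card_range, nsmul_eq_mul] at e2
    simp only [inarMean_innovation_id hlam] at e1
    calc _ = _ := lintegral_congr fun y => by ring
      _ = _ := e1
      _ = _ := lintegral_congr fun y => by ring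
      _ = _ := e2
      _ = _ := lintegral_congr fun y => by ring
  have h3 : ∫⁻ y, h y * ((y.2 (.innovation k) * (y.2 (.innovation k) - 1) : ℕ) : ℝ≥0∞) ∂M
      = ∫⁻ y, h y * ENNReal.ofReal lam ^ 2 ∂M := by
    have := hM (.innovation k) (fun l => ((l * (l - 1) : ℕ) : ℝ≥0∞)) h hh.measurable
      (hh.innovation k le_rfl)
    simpa only [inarMean_innovation_descFactorial hlam] using this
  have hpm : Measurable fun y : ℝ × (InarIndex → ℕ) => (inarPath y.2 k : ℝ≥0∞) :=
    (IsInarPredictable.of_path (fun l => (l : ℝ≥0∞)) (le_refl k)).measurable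
  simp only [hexp, mul_add]
  rw [lintegral_add_right _ (hh.measurable_mul hε2),
    lintegral_add_right _ (hh.measurable_mul ((hSm.fun_mul hε).const_mul 2)), h1, h2, h3,
    lintegral_add_right _ (hh.measurable_mul measurable_const),
    lintegral_add_right _ (hh.measurable_mul ((measurable_ofReal_fst.fun_mul hpm).const_mul _))]

end Moments

/-! ### Stationary moments and covariances of the centred process. -/

section StationaryMoments

variable {lam : ℝ} {M : Measure (ℝ × (InarIndex → ℕ))}

/-- The indicator of a parameter event can be absorbed into the test function. This serves both the
truncation of `α` away from `1` and the set integrals that characterize the conditional expectation.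
-/
theorem IsInputLaw.restrict_fst (hM : IsInputLaw lam M) {B : Set ℝ} (hB : MeasurableSet B) :
    IsInputLaw lam (M.restrict (Prod.fst ⁻¹' B)) := by
  intro i g h hh hinv
  have hBm : MeasurableSet (Prod.fst ⁻¹' B : Set (ℝ × (InarIndex → ℕ))) := measurable_fst hB
  have e := hM i g ((Prod.fst ⁻¹' B).indicator h) (hh.indicator hBm) (fun a z n => by
    by_cases ha : a ∈ B
    · simp [Set.indicator, ha, hinv]
    · simp [Set.indicator, ha])
  rw [← lintegral_indicator hBm, ← lintegral_indicator hBm]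
  calc _ = _ := lintegral_congr fun y => by rw [Set.indicator_mul_left]
    _ = _ := e
    _ = _ := lintegral_congr fun y => by rw [Set.indicator_mul_left]

/-- Stationarity of the mean: it is the fixed point of `m ↦ x * m + lam`. -/
theorem ofReal_mul_div_add {x : ℝ} (hlam : 0 ≤ lam) (hx : x ∈ Set.Ioo (0 : ℝ) 1) :
    ENNReal.ofReal x * ENNReal.ofReal (lam / (1 - x)) + ENNReal.ofReal lam
      = ENNReal.ofReal (lam / (1 - x)) := by
  have h1 : 0 < 1 - x := by linarith [hx.2]
  rw [← ENNReal.ofReal_mul hx.1.le, ← ENNReal.ofReal_add (mul_nonneg hx.1.le (by positivity)) hlam]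
  congr 1
  field_simp
  ring

theorem measurable_ofReal_div : Measurable fun x : ℝ => ENNReal.ofReal (lam / (1 - x)) := by
  fun_prop

/-- Conditional mean of a stationary INAR process. -/
theorem IsInputLaw.lintegral_path (hlam : 0 ≤ lam) (hM : IsInputLaw lam M)
    (h01 : ∀ᵐ y ∂M, y.1 ∈ Set.Ioo (0 : ℝ) 1) (k : ℕ) {f : ℝ → ℝ≥0∞} (hf : Measurable f) :
    ∫⁻ y, f y.1 * (inarPath y.2 k : ℝ≥0∞) ∂M
      = ∫⁻ y, f y.1 * ENNReal.ofReal (lam / (1 - y.1)) ∂M := by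
  induction k generalizing f with
  | zero =>
    have := hM .initial (fun l => (l : ℝ≥0∞)) (fun y => f y.1) (hf.comp measurable_fst)
      (fun _ _ _ => rfl)
    refine this.trans (lintegral_congr_ae ?_)
    filter_upwards [h01] with y hy
    rw [inarMean_initial_id hlam hy.2.le]
  | succ k ih =>
    have hf1 : Measurable fun x : ℝ => f x * ENNReal.ofReal x := hf.mul ENNReal.measurable_ofReal
    have hm : Measurable fun y : ℝ × (InarIndex → ℕ) => f y.1 * ENNReal.ofReal lam :=
      (hf.comp measurable_fst).mul_const _
    rw [hM.lintegral_path_succ hlam (.of_fst hf k)]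
    calc _ = ∫⁻ y, f y.1 * ENNReal.ofReal y.1 * (inarPath y.2 k : ℝ≥0∞)
          + f y.1 * ENNReal.ofReal lam ∂M := lintegral_congr fun y => by ring
      _ = ∫⁻ y, f y.1 * ENNReal.ofReal y.1 * ENNReal.ofReal (lam / (1 - y.1))
          + f y.1 * ENNReal.ofReal lam ∂M := by
          rw [lintegral_add_right _ hm, ih hf1, lintegral_add_right _ hm]
      _ = _ := by
          refine lintegral_congr_ae ?_
          filter_upwards [h01] with y hy
          rw [mul_assoc, ← mul_add, ofReal_mul_div_add hlam hy]

/-- Conditional second factorial moment of a stationary INAR process. -/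
theorem IsInputLaw.lintegral_descFactorial_path (hlam : 0 ≤ lam) (hM : IsInputLaw lam M)
    (h01 : ∀ᵐ y ∂M, y.1 ∈ Set.Ioo (0 : ℝ) 1) (k : ℕ) {f : ℝ → ℝ≥0∞} (hf : Measurable f) :
    ∫⁻ y, f y.1 * ((inarPath y.2 k * (inarPath y.2 k - 1) : ℕ) : ℝ≥0∞) ∂M
      = ∫⁻ y, f y.1 * ENNReal.ofReal (lam / (1 - y.1)) ^ 2 ∂M := by
  induction k generalizing f with
  | zero =>
    have := hM .initial (fun l => ((l * (l - 1) : ℕ) : ℝ≥0∞)) (fun y => f y.1)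
      (hf.comp measurable_fst) (fun _ _ _ => rfl)
    refine this.trans (lintegral_congr_ae ?_)
    filter_upwards [h01] with y hy
    rw [inarMean_initial_descFactorial hlam hy.2.le]
  | succ k ih =>
    have hf1 : Measurable fun x : ℝ => f x * (2 * ENNReal.ofReal lam) * ENNReal.ofReal x :=
      (hf.mul_const _).mul ENNReal.measurable_ofReal
    have hf2 : Measurable fun x : ℝ => f x * ENNReal.ofReal x ^ 2 :=
      hf.mul (ENNReal.measurable_ofReal.pow_const 2)
    have hm : Measurable fun y : ℝ × (InarIndex → ℕ) => f y.1 * ENNReal.ofReal lam ^ 2 :=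
      (hf.comp measurable_fst).mul_const _
    have hm1 : Measurable fun y : ℝ × (InarIndex → ℕ) =>
        f y.1 * (2 * ENNReal.ofReal lam) * ENNReal.ofReal y.1 * (inarPath y.2 k : ℝ≥0∞) :=
      (hf1.comp measurable_fst).mul
        (IsInarPredictable.of_path (fun l => (l : ℝ≥0∞)) (le_refl k)).measurable
    have hm2 : Measurable fun y : ℝ × (InarIndex → ℕ) =>
        f y.1 * (2 * ENNReal.ofReal lam) * ENNReal.ofReal y.1
          * ENNReal.ofReal (lam / (1 - y.1)) :=
      (hf1.mul measurable_ofReal_div).comp measurable_fst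
    rw [hM.lintegral_descFactorial_path_succ hlam (.of_fst hf k)]
    calc _ = ∫⁻ y, f y.1 * ENNReal.ofReal y.1 ^ 2
              * ((inarPath y.2 k * (inarPath y.2 k - 1) : ℕ) : ℝ≥0∞)
            + f y.1 * (2 * ENNReal.ofReal lam) * ENNReal.ofReal y.1 * (inarPath y.2 k : ℝ≥0∞)
            + f y.1 * ENNReal.ofReal lam ^ 2 ∂M := lintegral_congr fun y => by ring
      _ = ∫⁻ y, f y.1 * ENNReal.ofReal y.1 ^ 2 * ENNReal.ofReal (lam / (1 - y.1)) ^ 2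
            + f y.1 * (2 * ENNReal.ofReal lam) * ENNReal.ofReal y.1
              * ENNReal.ofReal (lam / (1 - y.1))
            + f y.1 * ENNReal.ofReal lam ^ 2 ∂M := by
          rw [lintegral_add_right _ hm, lintegral_add_right _ hm1, ih hf2,
            hM.lintegral_path hlam h01 k hf1, lintegral_add_right _ hm, lintegral_add_right _ hm2]
      _ = _ := by
          refine lintegral_congr_ae ?_
          filter_upwards [h01] with y hy
          -- The three terms form the square `(x * m + lam) ^ 2`, which is `m ^ 2` by the
          -- fixed-point equation.
          conv_rhs => rw [← ofReal_mul_div_add hlam hy]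
          ring

/-- Conditional mixed moments of a stationary INAR process. -/
theorem IsInputLaw.lintegral_path_mul_path (hlam : 0 ≤ lam) (hM : IsInputLaw lam M)
    (h01 : ∀ᵐ y ∂M, y.1 ∈ Set.Ioo (0 : ℝ) 1) (k d : ℕ) {f : ℝ → ℝ≥0∞} (hf : Measurable f) :
    ∫⁻ y, f y.1 * ((inarPath y.2 k : ℝ≥0∞) * (inarPath y.2 (k + d) : ℝ≥0∞)) ∂M
      = ∫⁻ y, f y.1 * (ENNReal.ofReal (lam / (1 - y.1)) ^ 2
          + ENNReal.ofReal y.1 ^ d * ENNReal.ofReal (lam / (1 - y.1))) ∂M := by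
  induction d generalizing f with
  | zero =>
    have hm : Measurable fun y : ℝ × (InarIndex → ℕ) => f y.1 * (inarPath y.2 k : ℝ≥0∞) :=
      (hf.comp measurable_fst).mul
        (IsInarPredictable.of_path (fun l => (l : ℝ≥0∞)) (le_refl k)).measurable
    have hm2 : Measurable fun y : ℝ × (InarIndex → ℕ) =>
        f y.1 * ENNReal.ofReal (lam / (1 - y.1)) :=
      (hf.mul measurable_ofReal_div).comp measurable_fst
    have hn : ∀ n : ℕ, (n : ℝ≥0∞) * n = ((n * (n - 1) : ℕ) : ℝ≥0∞) + n := by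
      intro n
      rw [← Nat.cast_mul, ← Nat.cast_add]
      congr 1
      rcases n with _ | n
      · simp
      · simp only [Nat.add_sub_cancel]; ring
    simp only [add_zero, hn, pow_zero, one_mul, mul_add]
    rw [lintegral_add_right _ hm, lintegral_add_right _ hm2, hM.lintegral_path hlam h01 k hf,
      hM.lintegral_descFactorial_path hlam h01 k hf]
  | succ d ih =>
    have hf1 : Measurable fun x : ℝ => f x * ENNReal.ofReal x := hf.mul ENNReal.measurable_ofReal
    have hf2 : Measurable fun x : ℝ => f x * ENNReal.ofReal lam := hf.mul_const _
    have hm : Measurable fun y : ℝ × (InarIndex → ℕ) =>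
        f y.1 * ENNReal.ofReal lam * (inarPath y.2 k : ℝ≥0∞) :=
      (hf2.comp measurable_fst).mul
        (IsInarPredictable.of_path (fun l => (l : ℝ≥0∞)) (le_refl k)).measurable
    have hm2 : Measurable fun y : ℝ × (InarIndex → ℕ) =>
        f y.1 * ENNReal.ofReal lam * ENNReal.ofReal (lam / (1 - y.1)) :=
      (hf2.mul measurable_ofReal_div).comp measurable_fst
    have hpred : IsInarPredictable (k + d) fun y => f y.1 * (inarPath y.2 k : ℝ≥0∞) :=
      (IsInarPredictable.of_fst hf _).mul (.of_path (fun l => (l : ℝ≥0∞)) (Nat.le_add_right k d))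
    calc _ = ∫⁻ y, f y.1 * (inarPath y.2 k : ℝ≥0∞) * (inarPath y.2 (k + d + 1) : ℝ≥0∞) ∂M :=
          lintegral_congr fun y => by rw [← add_assoc]; ring
      _ = _ := hM.lintegral_path_succ hlam hpred
      _ = ∫⁻ y, f y.1 * ENNReal.ofReal y.1
            * ((inarPath y.2 k : ℝ≥0∞) * (inarPath y.2 (k + d) : ℝ≥0∞))
            + f y.1 * ENNReal.ofReal lam * (inarPath y.2 k : ℝ≥0∞) ∂M :=
          lintegral_congr fun y => by ring
      _ = ∫⁻ y, f y.1 * ENNReal.ofReal y.1 * (ENNReal.ofReal (lam / (1 - y.1)) ^ 2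
            + ENNReal.ofReal y.1 ^ d * ENNReal.ofReal (lam / (1 - y.1)))
            + f y.1 * ENNReal.ofReal lam * ENNReal.ofReal (lam / (1 - y.1)) ∂M := by
          rw [lintegral_add_right _ hm, ih hf1, hM.lintegral_path hlam h01 k hf2,
            lintegral_add_right _ hm2]
      _ = _ := by
          refine lintegral_congr_ae ?_
          filter_upwards [h01] with y hy
          -- Only one factor of `m ^ 2` is replaced by `x * m + lam`, because the recursion acts on
          -- the later time alone.
          rw [sq]
          conv_rhs =>
            arg 2
            arg 1
            arg 1
            rw [← ofReal_mul_div_add hlam hy]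
          ring

theorem integrable_and_integral_eq_of_lintegral_eq {S : Type*} [MeasurableSpace S] {μ : Measure S}
    {F G : S → ℝ} (hF : AEStronglyMeasurable F μ) (hF0 : 0 ≤ᵐ[μ] F) (hG0 : 0 ≤ᵐ[μ] G)
    (hG : Integrable G μ)
    (h : ∫⁻ y, ENNReal.ofReal (F y) ∂μ = ∫⁻ y, ENNReal.ofReal (G y) ∂μ) :
    Integrable F μ ∧ ∫ y, F y ∂μ = ∫ y, G y ∂μ := by
  refine ⟨⟨hF, ?_⟩, ?_⟩
  · rw [hasFiniteIntegral_iff_ofReal hF0, h, ← hasFiniteIntegral_iff_ofReal hG0]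
    exact hG.2
  · rw [integral_eq_lintegral_of_nonneg_ae hF0 hF, integral_eq_lintegral_of_nonneg_ae hG0 hG.1, h]

theorem measurable_inarPath_real (k : ℕ) :
    Measurable fun y : ℝ × (InarIndex → ℕ) => (inarPath y.2 k : ℝ) :=
  (measurable_of_countable (fun l : ℕ => (l : ℝ))).comp
    ((measurable_inarPath k).comp measurable_snd)

theorem IsInputLaw.integral_path (hlam : 0 ≤ lam) (hM : IsInputLaw lam M)
    (h01 : ∀ᵐ y ∂M, y.1 ∈ Set.Ioo (0 : ℝ) 1)
    (h_int : Integrable (fun y : ℝ × (InarIndex → ℕ) => lam / (1 - y.1)) M) (k : ℕ) :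
    Integrable (fun y : ℝ × (InarIndex → ℕ) => (inarPath y.2 k : ℝ)) M ∧
      ∫ y, (inarPath y.2 k : ℝ) ∂M = ∫ y, lam / (1 - y.1) ∂M := by
  refine integrable_and_integral_eq_of_lintegral_eq
    (measurable_inarPath_real k).aestronglyMeasurable (.of_forall fun y => by positivity) ?_ h_int ?_
  · filter_upwards [h01] with y hy
    exact div_nonneg hlam (by linarith [hy.2])
  · have := hM.lintegral_path hlam h01 k (f := fun _ => 1) measurable_const
    simpa using this

/-- Centred mixed moments when the parameter stays away from `1`. -/
theorem IsInputLaw.integral_centred_mul_of_le [IsFiniteMeasure M] (hlam : 0 ≤ lam)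
    (hM : IsInputLaw lam M) (h01 : ∀ᵐ y ∂M, y.1 ∈ Set.Ioo (0 : ℝ) 1) {c : ℝ} (hc : c < 1)
    (hle : ∀ᵐ y ∂M, y.1 ≤ c) (k d : ℕ) :
    Integrable (fun y : ℝ × (InarIndex → ℕ) => ((inarPath y.2 k : ℝ) - lam / (1 - y.1))
        * ((inarPath y.2 (k + d) : ℝ) - lam / (1 - y.1))) M ∧
      ∫ y, ((inarPath y.2 k : ℝ) - lam / (1 - y.1))
        * ((inarPath y.2 (k + d) : ℝ) - lam / (1 - y.1)) ∂M
        = ∫ y, y.1 ^ d * (lam / (1 - y.1)) ∂M := by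
  have hmm : Measurable fun y : ℝ × (InarIndex → ℕ) => lam / (1 - y.1) := by fun_prop
  have hm0 : ∀ᵐ y ∂M, 0 ≤ lam / (1 - y.1) := by
    filter_upwards [h01] with y hy
    exact div_nonneg hlam (by linarith [hy.2])
  -- The bound on the parameter makes `lam / (1 - α)` bounded, hence its square integrable, so the
  -- centred product can be expanded term by term.
  have hmb : ∀ᵐ y ∂M, lam / (1 - y.1) ≤ lam / (1 - c) := by
    filter_upwards [hle] with y hy
    exact div_le_div_of_nonneg_left hlam (by linarith) (by linarith)
  have hmi : Integrable (fun y : ℝ × (InarIndex → ℕ) => lam / (1 - y.1)) M := by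
    refine Integrable.of_bound hmm.aestronglyMeasurable (lam / (1 - c)) ?_
    filter_upwards [hm0, hmb] with y h1 h2
    rwa [Real.norm_of_nonneg h1]
  have hmi2 : Integrable (fun y : ℝ × (InarIndex → ℕ) => lam / (1 - y.1) * (lam / (1 - y.1))) M := by
    refine hmi.bdd_mul (c := lam / (1 - c)) hmm.aestronglyMeasurable ?_
    filter_upwards [hm0, hmb] with y h1 h2
    rwa [Real.norm_of_nonneg h1]
  have hpi : Integrable (fun y : ℝ × (InarIndex → ℕ) => y.1 ^ d * (lam / (1 - y.1))) M := by
    refine hmi.bdd_mul (c := 1) (Measurable.aestronglyMeasurable (by fun_prop)) ?_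
    filter_upwards [h01] with y hy
    rw [norm_pow, Real.norm_of_nonneg hy.1.le]
    exact pow_le_one₀ hy.1.le hy.2.le
  have hXm : ∀ j, Integrable (fun y : ℝ × (InarIndex → ℕ) =>
        lam / (1 - y.1) * (inarPath y.2 j : ℝ)) M ∧
      ∫ y, lam / (1 - y.1) * (inarPath y.2 j : ℝ) ∂M
        = ∫ y, lam / (1 - y.1) * (lam / (1 - y.1)) ∂M := by
    intro j
    refine integrable_and_integral_eq_of_lintegral_eq
      (hmm.mul (measurable_inarPath_real j)).aestronglyMeasurable ?_ ?_ hmi2 ?_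
    · filter_upwards [hm0] with y h1
      exact mul_nonneg h1 (by positivity)
    · filter_upwards [hm0] with y h1
      exact mul_nonneg h1 h1
    · have := hM.lintegral_path hlam h01 j (measurable_ofReal_div (lam := lam))
      calc _ = _ := lintegral_congr_ae ?_
        _ = _ := this
        _ = _ := lintegral_congr_ae ?_
      · filter_upwards [hm0] with y h1
        rw [ENNReal.ofReal_mul h1, ENNReal.ofReal_natCast]
      · filter_upwards [hm0] with y h1
        rw [ENNReal.ofReal_mul h1]
  have hXX : Integrable (fun y : ℝ × (InarIndex → ℕ) =>
        (inarPath y.2 k : ℝ) * (inarPath y.2 (k + d) : ℝ)) M ∧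
      ∫ y, (inarPath y.2 k : ℝ) * (inarPath y.2 (k + d) : ℝ) ∂M
        = ∫ y, (lam / (1 - y.1) * (lam / (1 - y.1)) + y.1 ^ d * (lam / (1 - y.1))) ∂M := by
    refine integrable_and_integral_eq_of_lintegral_eq
      ((measurable_inarPath_real k).mul (measurable_inarPath_real (k + d))).aestronglyMeasurable
      (.of_forall fun y => by positivity) ?_ (hmi2.add hpi) ?_
    · filter_upwards [hm0, h01] with y h1 h2
      exact add_nonneg (mul_nonneg h1 h1) (mul_nonneg (pow_nonneg h2.1.le _) h1)
    · have := hM.lintegral_path_mul_path hlam h01 k d (f := fun _ => 1) measurable_const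
      simp only [one_mul] at this
      calc _ = _ := lintegral_congr fun y => ?_
        _ = _ := this
        _ = _ := lintegral_congr_ae ?_
      · rw [ENNReal.ofReal_mul (by positivity), ENNReal.ofReal_natCast, ENNReal.ofReal_natCast]
      · filter_upwards [hm0, h01] with y h1 h2
        rw [ENNReal.ofReal_add (mul_nonneg h1 h1) (mul_nonneg (pow_nonneg h2.1.le _) h1),
          ENNReal.ofReal_mul h1, ENNReal.ofReal_mul (pow_nonneg h2.1.le _),
          ENNReal.ofReal_pow h2.1.le, sq]
  have e : (fun y : ℝ × (InarIndex → ℕ) => ((inarPath y.2 k : ℝ) - lam / (1 - y.1))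
        * ((inarPath y.2 (k + d) : ℝ) - lam / (1 - y.1)))
      = fun y => (((inarPath y.2 k : ℝ) * (inarPath y.2 (k + d) : ℝ)
          - lam / (1 - y.1) * (inarPath y.2 k : ℝ)) - lam / (1 - y.1) * (inarPath y.2 (k + d) : ℝ))
          + lam / (1 - y.1) * (lam / (1 - y.1)) := by
    ext y; ring
  rw [e]
  have hi1 : Integrable (fun y : ℝ × (InarIndex → ℕ) =>
      (inarPath y.2 k : ℝ) * (inarPath y.2 (k + d) : ℝ)
        - lam / (1 - y.1) * (inarPath y.2 k : ℝ)) M := hXX.1.sub (hXm k).1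
  have hi2 : Integrable (fun y : ℝ × (InarIndex → ℕ) =>
      ((inarPath y.2 k : ℝ) * (inarPath y.2 (k + d) : ℝ) - lam / (1 - y.1) * (inarPath y.2 k : ℝ))
        - lam / (1 - y.1) * (inarPath y.2 (k + d) : ℝ)) M := hi1.sub (hXm (k + d)).1
  refine ⟨hi2.add hmi2, ?_⟩
  rw [integral_add hi2 hmi2, integral_sub hi1 (hXm (k + d)).1, integral_sub hXX.1 (hXm k).1, hXX.2,
    (hXm k).2, (hXm (k + d)).2, integral_add hmi2 hpi]
  ring

/-- The truncations exhaust the space because `α < 1` almost surely. They are needed since the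
square of `lam / (1 - α)` need not be integrable, although it cancels from the centred covariances.
-/
theorem aecover_fst_le (h01 : ∀ᵐ y ∂M, y.1 ∈ Set.Ioo (0 : ℝ) 1) :
    AECover M atTop fun n : ℕ => (Prod.fst ⁻¹' Set.Iic (1 - 1 / ((n : ℝ) + 1)) :
      Set (ℝ × (InarIndex → ℕ))) where
  ae_eventually_mem := by
    filter_upwards [h01] with y hy
    have h1 : Tendsto (fun n : ℕ => 1 - 1 / ((n : ℝ) + 1)) atTop (𝓝 (1 - 0)) :=
      tendsto_const_nhds.sub tendsto_one_div_add_atTop_nhds_zero_nat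
    rw [sub_zero] at h1
    filter_upwards [h1.eventually (lt_mem_nhds hy.2)] with n hn
    exact hn.le
  measurableSet n := measurable_fst measurableSet_Iic

/-- The centred process is square integrable, and its covariances are mixtures of geometric
sequences. -/
theorem IsInputLaw.memLp_and_integral_centred_mul [IsFiniteMeasure M] (hlam : 0 ≤ lam)
    (hM : IsInputLaw lam M) (h01 : ∀ᵐ y ∂M, y.1 ∈ Set.Ioo (0 : ℝ) 1)
    (h_int : Integrable (fun y : ℝ × (InarIndex → ℕ) => lam / (1 - y.1)) M) :
    (∀ k, MemLp (fun y : ℝ × (InarIndex → ℕ) => (inarPath y.2 k : ℝ) - lam / (1 - y.1)) 2 M) ∧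
      ∀ k d, ∫ y, ((inarPath y.2 k : ℝ) - lam / (1 - y.1))
        * ((inarPath y.2 (k + d) : ℝ) - lam / (1 - y.1)) ∂M
        = ∫ y, y.1 ^ d * (lam / (1 - y.1)) ∂M := by
  have hcov := aecover_fst_le h01
  have htr := fun (n : ℕ) (k d : ℕ) =>
    (hM.restrict_fst (B := Set.Iic (1 - 1 / ((n : ℝ) + 1))) measurableSet_Iic
      ).integral_centred_mul_of_le hlam
      (ae_restrict_of_ae h01) (c := 1 - 1 / ((n : ℝ) + 1)) (sub_lt_self _ (by positivity))
      (ae_restrict_mem (measurable_fst measurableSet_Iic)) k d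
  have hmm : Measurable fun y : ℝ × (InarIndex → ℕ) => lam / (1 - y.1) := by fun_prop
  have hDm : ∀ k, Measurable fun y : ℝ × (InarIndex → ℕ) =>
      (inarPath y.2 k : ℝ) - lam / (1 - y.1) := fun k => (measurable_inarPath_real k).sub hmm
  have hm0 : ∀ᵐ y ∂M, 0 ≤ lam / (1 - y.1) := by
    filter_upwards [h01] with y hy
    exact div_nonneg hlam (by linarith [hy.2])
  have hL : ∀ k, MemLp (fun y : ℝ × (InarIndex → ℕ) =>
      (inarPath y.2 k : ℝ) - lam / (1 - y.1)) 2 M := by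
    intro k
    rw [memLp_two_iff_integrable_sq (hDm k).aestronglyMeasurable]
    -- At lag `0` the truncated second moments equal truncated means of `lam / (1 - α)`, which
    -- bounds them uniformly.
    refine hcov.integrable_of_integral_bounded_of_nonneg_ae (∫ y, lam / (1 - y.1) ∂M)
      (fun n => ?_) (.of_forall fun y => sq_nonneg _) (.of_forall fun n => ?_)
    · have := (htr n k 0).1
      simp only [add_zero, ← sq] at this
      exact this
    · have := (htr n k 0).2
      simp only [add_zero, ← sq, pow_zero, one_mul] at this
      rw [this]
      exact setIntegral_le_integral h_int hm0
  refine ⟨hL, fun k d => ?_⟩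
  have hpi : Integrable (fun y : ℝ × (InarIndex → ℕ) => y.1 ^ d * (lam / (1 - y.1))) M := by
    refine h_int.bdd_mul (c := 1) (Measurable.aestronglyMeasurable (by fun_prop)) ?_
    filter_upwards [h01] with y hy
    rw [norm_pow, Real.norm_of_nonneg hy.1.le]
    exact pow_le_one₀ hy.1.le hy.2.le
  have h1 := hcov.integral_tendsto_of_countably_generated ((hL k).integrable_mul (hL (k + d)))
  have h2 := hcov.integral_tendsto_of_countably_generated hpi
  refine tendsto_nhds_unique h1 (h2.congr fun n => ?_)
  exact (htr n k d).2.symm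

end StationaryMoments

/-! ### The two successive limits for a general covariance sequence. -/

section IteratedLimit

variable {Ω : Type*} [MeasurableSpace Ω] {P : Measure Ω}

/-- Combining partial sums at several times gives one weighted sum over the underlying sequence. It
is applied both to paths and, in each variable, to the covariance form. -/
theorem sum_smul_sum_eq_sum_biUnion {I V : Type*} [Fintype I] [AddCommGroup V]
    [Module ℝ V] (w : I → ℝ) (s : I → Finset ℕ) (x : ℕ → V) :
    ∑ i, w i • ∑ k ∈ s i, x k
      = ∑ k ∈ Finset.univ.biUnion s, (∑ i, if k ∈ s i then w i else 0) • x k := by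
  simp only [Finset.sum_smul, Finset.smul_sum]
  rw [Finset.sum_comm]
  refine Finset.sum_congr rfl fun i _ => ?_
  rw [← Finset.sum_subset (Finset.subset_biUnion_of_mem s (Finset.mem_univ i))]
  · exact Finset.sum_congr rfl fun k hk => by rw [if_pos hk]
  · intro k _ hk
    rw [if_neg hk, zero_smul]

/-- The variance of a linear combination of a sequence with covariances `r |k - l|`. -/
noncomputable def quadForm (r : ℕ → ℝ) (s : Finset ℕ) (c : ℕ → ℝ) : ℝ :=
  ∑ k ∈ s, ∑ l ∈ s, c k * c l * r (Nat.dist k l)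

theorem quadForm_biUnion {I : Type*} [Fintype I] (r : ℕ → ℝ) (w : I → ℝ) (s : I → Finset ℕ) :
    quadForm r (Finset.univ.biUnion s) (fun k => ∑ i, if k ∈ s i then w i else 0)
      = ∑ i, ∑ j, w i * w j * ∑ k ∈ s i, ∑ l ∈ s j, r (Nat.dist k l) := by
  have h1 : ∀ k, ∑ l ∈ Finset.univ.biUnion s, (∑ i, if l ∈ s i then w i else 0) * r (Nat.dist k l)
      = ∑ j, w j * ∑ l ∈ s j, r (Nat.dist k l) := fun k => by
    simpa only [smul_eq_mul] using (sum_smul_sum_eq_sum_biUnion w s fun l => r (Nat.dist k l)).symm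
  have h2 := sum_smul_sum_eq_sum_biUnion w s fun k => ∑ j, w j * ∑ l ∈ s j, r (Nat.dist k l)
  simp only [smul_eq_mul] at h2
  simp only [quadForm, mul_assoc, ← Finset.mul_sum, h1]
  rw [← h2]
  refine Finset.sum_congr rfl fun i _ => ?_
  rw [Finset.sum_comm]
  simp only [Finset.mul_sum]

/-- The variables `D k` are themselves vectors in `L²` whose Gram matrix is `r |k - l|`, so
`exists_gaussian_sequence` applies without a separate positivity argument. -/
theorem exists_gaussian_sequence_of_covariance {D : ℕ → Ω → ℝ} {r : ℕ → ℝ}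
    (hL : ∀ k, MemLp (D k) 2 P) (hcov : ∀ k l, ∫ ω, D k ω * D l ω ∂P = r (Nat.dist k l)) :
    ∃ ρ : Measure (ℕ → ℝ), IsProbabilityMeasure ρ ∧ ∀ (s : Finset ℕ) (c : ℕ → ℝ),
      HasLaw (fun x : ℕ → ℝ => ∑ k ∈ s, c k * x k) (gaussianReal 0 (quadForm r s c).toNNReal) ρ := by
  obtain ⟨ρ, hρ, hlaw⟩ := exists_gaussian_sequence fun k => (hL k).toLp (D k)
  refine ⟨ρ, hρ, fun s c => ?_⟩
  have hin : ∀ k l, inner ℝ ((hL k).toLp (D k)) ((hL l).toLp (D l)) = r (Nat.dist k l) := by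
    intro k l
    rw [← hcov, L2.inner_def]
    refine integral_congr_ae ?_
    filter_upwards [(hL k).coeFn_toLp, (hL l).coeFn_toLp] with ω h1 h2
    rw [h1, h2]
    simp [mul_comm]
  have hq : ‖∑ k ∈ s, c k • (hL k).toLp (D k)‖ ^ 2 = quadForm r s c := by
    rw [← real_inner_self_eq_norm_sq, sum_inner]
    refine Finset.sum_congr rfl fun k _ => ?_
    rw [inner_sum]
    refine Finset.sum_congr rfl fun l _ => ?_
    rw [real_inner_smul_left, real_inner_smul_right, hin]
    ring
  rw [← hq]
  exact hlaw s c

theorem variance_sum_mul [IsProbabilityMeasure P] {D : ℕ → Ω → ℝ} {r : ℕ → ℝ}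
    (hL : ∀ k, MemLp (D k) 2 P) (hmean : ∀ k, ∫ ω, D k ω ∂P = 0)
    (hcov : ∀ k l, ∫ ω, D k ω * D l ω ∂P = r (Nat.dist k l)) (s : Finset ℕ) (c : ℕ → ℝ) :
    Var[fun ω => ∑ k ∈ s, c k * D k ω; P] = quadForm r s c := by
  rw [variance_fun_sum' fun k _ => (hL k).const_mul (c k)]
  refine Finset.sum_congr rfl fun k _ => Finset.sum_congr rfl fun l _ => ?_
  rw [covariance_const_mul_left, covariance_const_mul_right, covariance_eq_sub (hL k) (hL l),
    hmean k, hmean l, zero_mul, sub_zero]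
  have : ∫ ω, (D k * D l) ω ∂P = r (Nat.dist k l) := hcov k l
  rw [this]
  ring

/-- Law of the linear combinations of a scaled fractional Brownian motion. -/
theorem IsFractionalBM.hasLaw_sum {Ω' : Type*} [MeasurableSpace Ω'] {Q : Measure Ω'}
    [IsProbabilityMeasure Q] {H : ℝ} {B : ℝ≥0 → Ω' → ℝ} (hB : IsFractionalBM H B Q) {C : ℝ}
    (hC : 0 ≤ C) (I : Finset ℝ≥0) (v : I → ℝ) :
    HasLaw (fun ω => ∑ i, v i * (√C * B i ω))
      (gaussianReal 0 (∑ i, ∑ j, v i * v j * (C * ((((i : ℝ≥0) : ℝ) ^ (2 * H)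
        + ((j : ℝ≥0) : ℝ) ^ (2 * H) - |((j : ℝ≥0) : ℝ) - ((i : ℝ≥0) : ℝ)| ^ (2 * H)) / 2))).toNNReal)
      Q := by
  have hI := hB.gaussian.hasGaussianLaw I
  set L : (I → ℝ) →L[ℝ] ℝ := ∑ i, (v i * √C) • ContinuousLinearMap.proj (R := ℝ) i
  have hLeq : (fun ω => L (I.restrict (B · ω))) = fun ω => ∑ i, v i * (√C * B i ω) := by
    ext ω
    simp [L, mul_assoc]
  have hG : HasGaussianLaw (fun ω => ∑ i, v i * (√C * B i ω)) Q := hLeq ▸ hI.map_fun L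
  have hBL : ∀ i : I, MemLp (B i) 2 Q := fun i =>
    (hI.map_fun (ContinuousLinearMap.proj (R := ℝ) i)).memLp_two
  refine ⟨hG.aemeasurable, ?_⟩
  rw [hG.map_eq_gaussianReal]
  congr 1
  · rw [integral_finsetSum _ fun i _ =>
      (((hBL i).integrable one_le_two).const_mul _).const_mul _]
    refine Finset.sum_eq_zero fun i _ => ?_
    rw [integral_const_mul, integral_const_mul, hB.mean_zero]
    simp
  · congr 1
    rw [variance_fun_sum fun i => ((hBL i).const_mul _).const_mul _]
    refine Finset.sum_congr rfl fun i _ => Finset.sum_congr rfl fun j _ => ?_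
    rw [covariance_const_mul_left, covariance_const_mul_left, covariance_const_mul_right,
      covariance_const_mul_right, hB.covariance_eq]
    have := Real.mul_self_sqrt hC
    linear_combination (v i * v j * ((((i : ℝ≥0) : ℝ) ^ (2 * H)
        + ((j : ℝ≥0) : ℝ) ^ (2 * H) - |((j : ℝ≥0) : ℝ) - ((i : ℝ≥0) : ℝ)| ^ (2 * H)) / 2)) * this

theorem sum_Icc_dist (r : ℕ → ℝ) (a b : ℕ) :
    ∑ k ∈ Finset.Icc 1 a, ∑ l ∈ Finset.Icc 1 b, r (Nat.dist k l)
      = ∑ k ∈ Finset.range a, ∑ l ∈ Finset.range b, r (Nat.dist k l) := by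
  have h : ∀ (m : ℕ) (f : ℕ → ℝ), ∑ k ∈ Finset.Icc 1 m, f k = ∑ k ∈ Finset.range m, f (k + 1) := by
    intro m f
    rw [Finset.range_eq_Ico, Finset.sum_Ico_add' f 0 m 1]
    rfl
  simp only [h, Nat.dist_add_add_right]

/-- Iterated limit theorem for partial sums of independent copies of a centred stationary sequence
with regularly varying covariances. -/
theorem iteratedFddLimit_of_covariance [IsProbabilityMeasure P] {Ω' : Type*} [MeasurableSpace Ω'] {Q : Measure Ω'}
    [IsProbabilityMeasure Q] {β c : ℝ} (hβ : β ∈ Set.Ioo (0 : ℝ) 1) (hc : 0 ≤ c)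
    {D : ℕ → ℕ → Ω → ℝ} {r : ℕ → ℝ}
    (hr : Tendsto (fun m : ℕ => (m : ℝ) ^ β * r m) atTop (𝓝 c))
    (hL : ∀ k, MemLp (D 0 k) 2 P) (hmean : ∀ k, ∫ ω, D 0 k ω ∂P = 0)
    (hcov : ∀ k l, ∫ ω, D 0 k ω * D 0 l ω ∂P = r (Nat.dist k l))
    (hindep : iIndepFun (fun j ω k => D j k ω) P)
    (hident : ∀ j, IdentDistrib (fun ω k => D j k ω) (fun ω k => D 0 k ω) P P)
    {B : ℝ≥0 → Ω' → ℝ} (hB : IsFractionalBM (1 - β / 2) B Q) :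
    IteratedFddLimit
      (fun (N n : ℕ) (t : ℝ≥0) ω => (n : ℝ) ^ (-1 + β / 2) * (N : ℝ) ^ (-(1 / 2) : ℝ) *
        ∑ j ∈ Finset.range N, ∑ k ∈ Finset.Icc 1 ⌊(n : ℝ) * (t : ℝ)⌋₊, D j k ω)
      P (fun t ω => √(2 * c / ((1 - β) * (2 - β))) * B t ω) Q := by
  obtain ⟨ρ, hρ, hlaw⟩ := exists_gaussian_sequence_of_covariance hL hcov
  -- The limit process for fixed `n`: the scaled partial sums of the Gaussian sequence with law `ρ`.
  set G : ℕ → (ℕ → ℝ) → ℝ≥0 → ℝ := fun n x t =>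
    (n : ℝ) ^ (-1 + β / 2) * ∑ k ∈ Finset.Icc 1 ⌊(n : ℝ) * (t : ℝ)⌋₊, x k with hG
  have hGm : ∀ n, Measurable (G n) := fun n => by
    refine measurable_pi_lambda _ fun t => ?_
    fun_prop
  set ν : ℕ → ProbabilityMeasure (ℝ≥0 → ℝ) := fun n =>
    ⟨ρ.map (G n), Measure.isProbabilityMeasure_map (hGm n).aemeasurable⟩ with hν
  have hDm : ∀ j k, AEMeasurable (D j k) P := fun j k =>
    (measurable_pi_apply k).comp_aemeasurable (hident j).aemeasurable_fst
  set S : ∀ (n : ℕ) (I : Finset ℝ≥0), I → Finset ℕ := fun n I i =>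
    Finset.Icc 1 ⌊(n : ℝ) * ((i : ℝ≥0) : ℝ)⌋₊ with hS
  set U : ∀ (n : ℕ) (I : Finset ℝ≥0), Finset ℕ := fun n I => Finset.univ.biUnion (S n I) with hU
  set a : ∀ (n : ℕ) (I : Finset ℝ≥0), (I → ℝ) → ℕ → ℝ := fun n I v k =>
    ∑ i, if k ∈ S n I i then v i * (n : ℝ) ^ (-1 + β / 2) else 0 with ha
  have hcomb : ∀ (n : ℕ) (I : Finset ℝ≥0) (v : I → ℝ) (x : ℕ → ℝ),
      ∑ i, v i * ((n : ℝ) ^ (-1 + β / 2) * ∑ k ∈ S n I i, x k) = ∑ k ∈ U n I, a n I v k * x k := by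
    intro n I v x
    have := sum_smul_sum_eq_sum_biUnion (fun i => v i * (n : ℝ) ^ (-1 + β / 2)) (S n I) x
    simp only [smul_eq_mul] at this
    rw [hU, ha, ← this]
    exact Finset.sum_congr rfl fun i _ => by ring
  have hνlaw : ∀ (n : ℕ) (I : Finset ℝ≥0) (v : I → ℝ), HasLaw (fun x : ℝ≥0 → ℝ => ∑ i : I, v i * x i)
      (gaussianReal 0 (quadForm r (U n I) (a n I v)).toNNReal) (ν n : Measure (ℝ≥0 → ℝ)) := by
    intro n I v
    refine ⟨Measurable.aemeasurable (by fun_prop), ?_⟩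
    have h1 : (ν n : Measure (ℝ≥0 → ℝ)) = ρ.map (G n) := rfl
    rw [h1, Measure.map_map (by fun_prop) (hGm n), ← (hlaw (U n I) (a n I v)).map_eq]
    congr 1
    ext x
    exact hcomb n I v x
  refine ⟨ν, fun n _ I => ?_, fun I => ?_⟩
  · refine tendstoInDistribution_pi_of_linear (fun N => ?_) ?_ fun v => ?_
    · refine aemeasurable_pi_lambda _ fun i => ?_
      exact (Finset.aemeasurable_fun_sum _ fun j _ =>
        Finset.aemeasurable_fun_sum _ fun k _ => hDm j k).const_mul _
    · exact (measurable_pi_lambda _ fun i => measurable_pi_apply _).aemeasurable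
    · set u : (ℕ → ℝ) → ℝ := fun x => ∑ k ∈ U n I, a n I v k * x k with hu
      have hum : Measurable u := by fun_prop
      have h_int : ∫ ω, u (fun k => D 0 k ω) ∂P = 0 := by
        simp only [hu]
        rw [integral_finsetSum _ fun k _ => ((hL k).integrable one_le_two).const_mul _]
        refine Finset.sum_eq_zero fun k _ => ?_
        rw [integral_const_mul, hmean, mul_zero]
      have hvar : Var[fun ω => u (fun k => D 0 k ω); P] = quadForm r (U n I) (a n I v) :=
        variance_sum_mul hL hmean hcov _ _
      -- By Cramér-Wold one fixed functional `u` of each copy suffices; the copies of it are i.i.d.,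
      -- centred, and have the variance of the Gaussian candidate.
      have hclt := tendstoInDistribution_inv_sqrt_mul_sum_sub (P := P)
        (P' := (ν n : Measure (ℝ≥0 → ℝ))) (X := fun j ω => u (fun k => D j k ω))
        (Y := fun x : ℝ≥0 → ℝ => ∑ i : I, v i * x i)
        (by rw [hvar]; exact hνlaw n I v)
        (memLp_finsetSum _ fun k _ => (hL k).const_mul _)
        (hindep.comp (fun _ => u) fun _ => hum)
        (fun j => (hident j).comp hum)
      simp only [h_int, mul_zero, sub_zero] at hclt
      refine hclt.congr (fun N => .of_forall fun ω => ?_) (.of_forall fun x => rfl)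
      have hN : (N : ℝ) ^ (-(1 / 2) : ℝ) = (√N)⁻¹ := by
        rw [Real.rpow_neg (by positivity), Real.sqrt_eq_rpow]
      simp only [hu, ← hcomb, Finset.restrict, hN]
      rw [Finset.sum_comm, Finset.mul_sum]
      refine Finset.sum_congr rfl fun i _ => ?_
      simp only [Finset.mul_sum]
      refine Finset.sum_congr rfl fun j _ => Finset.sum_congr rfl fun k _ => ?_
      ring
  · set C := 2 * c / ((1 - β) * (2 - β)) with hCdef
    have hC : 0 ≤ C := div_nonneg (by linarith)
      (mul_nonneg (by linarith [hβ.2]) (by linarith [hβ.2]))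
    refine tendstoInDistribution_pi_of_linear (fun N => ?_) ?_ fun v => ?_
    · exact (measurable_pi_lambda _ fun i => measurable_pi_apply _).aemeasurable
    · refine aemeasurable_pi_lambda _ fun i => ?_
      exact ((measurable_pi_apply i).comp_aemeasurable
        (hB.gaussian.hasGaussianLaw I).aemeasurable).const_mul _
    -- Both sides are centred Gaussian, so the second limit reduces to convergence of the quadratic
    -- forms.
    · refine tendstoInDistribution_of_hasLaw_gaussianReal (fun n => hνlaw n I v)
        (hB.hasLaw_sum hC I v) ?_
      have hq : ∀ n, quadForm r (U n I) (a n I v) = ∑ i : I, ∑ j : I, v i * v j *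
          (((n : ℝ) ^ (-1 + β / 2)) ^ 2 * ∑ k ∈ Finset.range ⌊(n : ℝ) * ((i : ℝ≥0) : ℝ)⌋₊,
            ∑ l ∈ Finset.range ⌊(n : ℝ) * ((j : ℝ≥0) : ℝ)⌋₊, r (Nat.dist k l)) := by
        intro n
        simp only [ha, hU]
        rw [quadForm_biUnion]
        refine Finset.sum_congr rfl fun i _ => Finset.sum_congr rfl fun j _ => ?_
        rw [hS, sum_Icc_dist]
        ring
      simp only [hq]
      refine tendsto_finsetSum _ fun i _ => tendsto_finsetSum _ fun j _ => ?_
      refine Tendsto.const_mul _ ?_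
      have := tendsto_rpow_mul_sum_rectangle hβ hr (i : ℝ≥0) (j : ℝ≥0)
      rw [show 2 * (1 - β / 2) = 2 - β by ring]
      refine this.congr fun n => ?_
      -- The squared normalization is `n ^ (-(2 - β))`, the growth rate of the rectangle sums.
      rw [← Real.rpow_natCast ((n : ℝ) ^ (-1 + β / 2)), ← Real.rpow_mul (by positivity)]
      congr 2
      push_cast
      ring

end IteratedLimit

/-! ### Transfer from the input space back to the given processes. -/

section CentredProcess

variable {Ω : Type*} [MeasurableSpace Ω] {P : Measure Ω} {lam : ℝ}
  {α : Ω → ℝ} {X : ℕ → Ω → ℕ} {ε : ℕ → Ω → ℕ} {ξ : ℕ → ℕ → Ω → ℕ}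

theorem IsRandomizedInar.ae_inarLaw (h : IsRandomizedInar P lam α X ε ξ) :
    ∀ᵐ y ∂(inarLaw P α (X 0) ε ξ), y.1 ∈ Set.Ioo (0 : ℝ) 1 := by
  rw [inarLaw, ae_map_iff h.measurable_pair.aemeasurable (measurable_fst measurableSet_Ioo)]
  exact h.param_mem

theorem isProbabilityMeasure_inarLaw [IsProbabilityMeasure P]
    (h : IsRandomizedInar P lam α X ε ξ) :
    IsProbabilityMeasure (inarLaw P α (X 0) ε ξ) :=
  Measure.isProbabilityMeasure_map h.measurable_pair.aemeasurable

theorem IsRandomizedInar.integrable_inarLaw (h : IsRandomizedInar P lam α X ε ξ)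
    (h_int : Integrable (fun x => lam / (1 - x)) (P.map α)) :
    Integrable (fun y : ℝ × (InarIndex → ℕ) => lam / (1 - y.1)) (inarLaw P α (X 0) ε ξ) := by
  rw [← map_fst_inarLaw h] at h_int
  exact h_int.comp_measurable measurable_fst

/-- The conditional expectation of a stationary randomized INAR process. -/
theorem IsRandomizedInar.condExp_eq [IsProbabilityMeasure P]
    (hlam : 0 ≤ lam) (h : IsRandomizedInar P lam α X ε ξ)
    (h_int : Integrable (fun x => lam / (1 - x)) (P.map α)) (k : ℕ) :
    P[fun ω => (X k ω : ℝ) | sigmaOf α] =ᵐ[P] fun ω => lam / (1 - α ω) := by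
  have := isProbabilityMeasure_inarLaw h
  have hi := h.integrable_inarLaw h_int
  have hdiv : Measurable fun x : ℝ => lam / (1 - x) := by fun_prop
  have hdiv' : Measurable fun y : ℝ × (InarIndex → ℕ) => lam / (1 - y.1) :=
    hdiv.comp measurable_fst
  have hiα : Integrable (fun ω => lam / (1 - α ω)) P :=
    h_int.comp_measurable h.measurable_param
  have hXeq : (fun ω => (X k ω : ℝ)) = (fun y : ℝ × (InarIndex → ℕ) => (inarPath y.2 k : ℝ)) ∘
      fun ω => (α ω, fun i => inarInput (X 0) ε ξ i ω) := by
    ext ω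
    simp [h.eq_inarPath k ω]
  have hXi : Integrable (fun ω => (X k ω : ℝ)) P := by
    rw [hXeq]
    exact (h.isInputLaw.integral_path hlam h.ae_inarLaw hi k).1.comp_measurable h.measurable_pair
  symm
  refine ae_eq_condExp_of_forall_setIntegral_eq h.measurable_param.comap_le hXi
    (fun s _ _ => hiα.integrableOn) ?_ ?_
  · rintro _ ⟨B, hB, rfl⟩ _
    have hBm : MeasurableSet (Prod.fst ⁻¹' B : Set (ℝ × (InarIndex → ℕ))) := measurable_fst hB
    -- Events in the σ-algebra of `α` are parameter events, and the law restricted to such an event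
    -- is again an input law; the mean identity there is the defining property of the conditional
    -- expectation.
    have key := ((h.isInputLaw.restrict_fst hB).integral_path hlam
      (ae_restrict_of_ae h.ae_inarLaw) hi.integrableOn k).2
    rw [inarLaw, setIntegral_map hBm (measurable_inarPath_real k).aestronglyMeasurable
      h.measurable_pair.aemeasurable, setIntegral_map hBm
      hdiv'.aestronglyMeasurable h.measurable_pair.aemeasurable] at key
    rw [hXeq]
    exact key.symm
  · exact (hdiv.comp (comap_measurable α)).stronglyMeasurable.aestronglyMeasurable

/-- The path of the process centred by its conditional mean, as a function of the inputs. -/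
noncomputable def centredPath (lam : ℝ) (y : ℝ × (InarIndex → ℕ)) (k : ℕ) : ℝ :=
  (inarPath y.2 k : ℝ) - lam / (1 - y.1)

theorem measurable_centredPath (lam : ℝ) : Measurable (centredPath lam) := by
  refine measurable_pi_lambda _ fun k => (measurable_inarPath_real k).sub ?_
  fun_prop

theorem IsRandomizedInar.centred_eq (h : IsRandomizedInar P lam α X ε ξ) (k : ℕ) (ω : Ω) :
    (X k ω : ℝ) - lam / (1 - α ω)
      = centredPath lam (α ω, fun i => inarInput (X 0) ε ξ i ω) k := by
  rw [centredPath, ← h.eq_inarPath]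

theorem IsRandomizedInar.memLp_centred [IsProbabilityMeasure P]
    (hlam : 0 ≤ lam) (h : IsRandomizedInar P lam α X ε ξ)
    (h_int : Integrable (fun x => lam / (1 - x)) (P.map α)) (k : ℕ) :
    MemLp (fun ω => (X k ω : ℝ) - lam / (1 - α ω)) 2 P := by
  have := isProbabilityMeasure_inarLaw h
  have hL := (h.isInputLaw.memLp_and_integral_centred_mul hlam h.ae_inarLaw
    (h.integrable_inarLaw h_int)).1 k
  have hmp : MeasurePreserving (fun ω => (α ω, fun i => inarInput (X 0) ε ξ i ω)) P
      (inarLaw P α (X 0) ε ξ) := h.measurable_pair.measurePreserving P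
  refine (hL.comp_measurePreserving hmp).ae_eq (.of_forall fun ω => ?_)
  exact (h.centred_eq k ω).symm

theorem IsRandomizedInar.integral_centred [IsProbabilityMeasure P]
    (hlam : 0 ≤ lam) (h : IsRandomizedInar P lam α X ε ξ)
    (h_int : Integrable (fun x => lam / (1 - x)) (P.map α)) (k : ℕ) :
    ∫ ω, ((X k ω : ℝ) - lam / (1 - α ω)) ∂P = 0 := by
  have hi := h.integrable_inarLaw h_int
  have hp := h.isInputLaw.integral_path hlam h.ae_inarLaw hi k
  simp only [h.centred_eq]
  rw [← integral_map (f := fun y => centredPath lam y k) h.measurable_pair.aemeasurable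
    ((measurable_pi_apply k).comp (measurable_centredPath lam)).aestronglyMeasurable]
  change ∫ y, ((inarPath y.2 k : ℝ) - lam / (1 - y.1)) ∂(inarLaw P α (X 0) ε ξ) = 0
  rw [integral_sub hp.1 hi, hp.2, sub_self]

theorem IsRandomizedInar.integral_centred_mul [IsProbabilityMeasure P]
    (hlam : 0 ≤ lam)
    (h : IsRandomizedInar P lam α X ε ξ)
    (h_int : Integrable (fun x => lam / (1 - x)) (P.map α)) (k l : ℕ) :
    ∫ ω, ((X k ω : ℝ) - lam / (1 - α ω)) * ((X l ω : ℝ) - lam / (1 - α ω)) ∂P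
      = ∫ x, x ^ Nat.dist k l * (lam / (1 - x)) ∂(P.map α) := by
  wlog hkl : k ≤ l generalizing k l
  · rw [Nat.dist_comm, ← this l k (le_of_not_ge hkl)]
    exact integral_congr_ae (.of_forall fun ω => mul_comm _ _)
  obtain ⟨d, rfl⟩ := Nat.exists_eq_add_of_le hkl
  have := isProbabilityMeasure_inarLaw h
  have hC := (h.isInputLaw.memLp_and_integral_centred_mul hlam h.ae_inarLaw
    (h.integrable_inarLaw h_int)).2 k d
  rw [Nat.dist_eq_sub_of_le hkl, Nat.add_sub_cancel_left]
  have hdm : Measurable fun x : ℝ => x ^ d * (lam / (1 - x)) := by fun_prop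
  have hk := fun k => (measurable_pi_apply k).comp (measurable_centredPath lam)
  simp only [h.centred_eq]
  rw [← integral_map (f := fun y => centredPath lam y k * centredPath lam y (k + d))
    h.measurable_pair.aemeasurable ((hk k).mul (hk (k + d))).aestronglyMeasurable]
  refine hC.trans ?_
  rw [← map_fst_inarLaw h, integral_map measurable_fst.aemeasurable hdm.aestronglyMeasurable]

/-- Two randomized INAR processes with the same parameter law have the same centred paths in
distribution. -/
theorem IsRandomizedInar.identDistrib_centred [IsProbabilityMeasure P]
    {α' : Ω → ℝ} {X' : ℕ → Ω → ℕ} {ε' : ℕ → Ω → ℕ}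
    {ξ' : ℕ → ℕ → Ω → ℕ} (h : IsRandomizedInar P lam α X ε ξ)
    (h' : IsRandomizedInar P lam α' X' ε' ξ') (hα : P.map α = P.map α') :
    IdentDistrib (fun ω k => (X k ω : ℝ) - lam / (1 - α ω))
      (fun ω k => (X' k ω : ℝ) - lam / (1 - α' ω)) P P := by
  have := isProbabilityMeasure_inarLaw h
  have hlaw : inarLaw P α (X 0) ε ξ = inarLaw P α' (X' 0) ε' ξ' :=
    h.isInputLaw.eq_of_map_fst_eq h'.isInputLaw (by rw [map_fst_inarLaw h, map_fst_inarLaw h', hα])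
  have hid : IdentDistrib (fun ω => (α ω, fun i => inarInput (X 0) ε ξ i ω))
      (fun ω => (α' ω, fun i => inarInput (X' 0) ε' ξ' i ω)) P P :=
    ⟨h.measurable_pair.aemeasurable, h'.measurable_pair.aemeasurable, hlaw⟩
  have hc := hid.comp (measurable_centredPath lam)
  simp only [h.centred_eq, h'.centred_eq]
  exact hc

end CentredProcess

/-! ### Integrals against the law of the thinning parameter. -/

section ParameterDensity

variable {lam β ψ₁ : ℝ} {ψ : ℝ → ℝ}

theorem aemeasurable_ofReal_density
    (hψ_meas : AEMeasurable ψ (volume.restrict (Set.Ioo (0 : ℝ) 1))) :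
    AEMeasurable (fun x => ENNReal.ofReal (ψ x * (1 - x) ^ β))
      (volume.restrict (Set.Ioo (0 : ℝ) 1)) :=
  (hψ_meas.mul (Measurable.aemeasurable (by fun_prop))).ennreal_ofReal

theorem integrableOn_density {μ : Measure ℝ} [IsFiniteMeasure μ]
    (hψ_meas : AEMeasurable ψ (volume.restrict (Set.Ioo (0 : ℝ) 1)))
    (hψ_nonneg : ∀ x ∈ Set.Ioo (0 : ℝ) 1, 0 ≤ ψ x)
    (hμ : μ = (volume.restrict (Set.Ioo (0 : ℝ) 1)).withDensity
      (fun x => ENNReal.ofReal (ψ x * (1 - x) ^ β))) :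
    IntegrableOn (fun x => ψ x * (1 - x) ^ β) (Set.Ioo 0 1) := by
  refine ⟨(hψ_meas.mul (Measurable.aemeasurable (by fun_prop))).aestronglyMeasurable, ?_⟩
  rw [hasFiniteIntegral_iff_ofReal]
  · have h := measure_lt_top μ Set.univ
    rwa [hμ, withDensity_apply _ MeasurableSet.univ, Measure.restrict_univ] at h
  · filter_upwards [ae_restrict_mem measurableSet_Ioo] with x hx
    exact mul_nonneg (hψ_nonneg x hx) (Real.rpow_nonneg (by linarith [hx.2]) _)

/-- The stationary mean lowers the exponent of `1 - x` from `β` to `β - 1`, which turns the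
covariances into the moments studied above. -/
theorem toReal_density_smul {x : ℝ} (hψ_nonneg : ∀ x ∈ Set.Ioo (0 : ℝ) 1, 0 ≤ ψ x)
    (hx : x ∈ Set.Ioo (0 : ℝ) 1) (d : ℕ) :
    (ENNReal.ofReal (ψ x * (1 - x) ^ β)).toReal • (x ^ d * (lam / (1 - x)))
      = lam * (x ^ d * (ψ x * (1 - x) ^ (β - 1))) := by
  have h1 : 0 < 1 - x := by linarith [hx.2]
  rw [ENNReal.toReal_ofReal (mul_nonneg (hψ_nonneg x hx) (Real.rpow_nonneg h1.le _)),
    Real.rpow_sub h1, Real.rpow_one, smul_eq_mul]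
  ring

theorem integrable_div_one_sub_of_density {μ : Measure ℝ} [IsFiniteMeasure μ]
    (hβ : β ∈ Set.Ioo (0 : ℝ) 1)
    (hψ_meas : AEMeasurable ψ (volume.restrict (Set.Ioo (0 : ℝ) 1)))
    (hψ_nonneg : ∀ x ∈ Set.Ioo (0 : ℝ) 1, 0 ≤ ψ x)
    (hψ_lim : Tendsto ψ (𝓝[<] 1) (𝓝 ψ₁))
    (hμ : μ = (volume.restrict (Set.Ioo (0 : ℝ) 1)).withDensity
      (fun x => ENNReal.ofReal (ψ x * (1 - x) ^ β))) :
    Integrable (fun x => lam / (1 - x)) μ := by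
  have hd := integrableOn_mul_one_sub_rpow_sub_one hβ hψ_meas hψ_nonneg hψ_lim
    (integrableOn_density hψ_meas hψ_nonneg hμ)
  rw [hμ, integrable_withDensity_iff_integrable_smul₀'
    (aemeasurable_ofReal_density hψ_meas) (.of_forall fun x => ENNReal.ofReal_lt_top)]
  refine (hd.const_mul lam).congr ?_
  filter_upwards [ae_restrict_mem measurableSet_Ioo] with x hx
  simpa using (toReal_density_smul (lam := lam) (β := β) hψ_nonneg hx 0).symm

theorem tendsto_rpow_mul_integral_density {μ : Measure ℝ} [IsFiniteMeasure μ]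
    (hβ : β ∈ Set.Ioo (0 : ℝ) 1)
    (hψ_meas : AEMeasurable ψ (volume.restrict (Set.Ioo (0 : ℝ) 1)))
    (hψ_nonneg : ∀ x ∈ Set.Ioo (0 : ℝ) 1, 0 ≤ ψ x)
    (hψ_lim : Tendsto ψ (𝓝[<] 1) (𝓝 ψ₁))
    (hμ : μ = (volume.restrict (Set.Ioo (0 : ℝ) 1)).withDensity
      (fun x => ENNReal.ofReal (ψ x * (1 - x) ^ β))) :
    Tendsto (fun m : ℕ => (m : ℝ) ^ β * ∫ x, x ^ m * (lam / (1 - x)) ∂μ) atTop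
      (𝓝 (lam * (ψ₁ * Real.Gamma β))) := by
  have hd := integrableOn_mul_one_sub_rpow_sub_one hβ hψ_meas hψ_nonneg hψ_lim
    (integrableOn_density hψ_meas hψ_nonneg hμ)
  refine ((tendsto_rpow_mul_integral_pow_mul hβ hψ_lim hd).const_mul lam).congr fun m => ?_
  rw [hμ, integral_withDensity_eq_integral_toReal_smul₀
    (aemeasurable_ofReal_density hψ_meas) (.of_forall fun x => ENNReal.ofReal_lt_top)]
  have : ∫ x in Set.Ioo (0 : ℝ) 1,
      (ENNReal.ofReal (ψ x * (1 - x) ^ β)).toReal • (x ^ m * (lam / (1 - x)))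
      = ∫ x in Set.Ioo (0 : ℝ) 1, lam * (x ^ m * (ψ x * (1 - x) ^ (β - 1))) :=
    setIntegral_congr_fun measurableSet_Ioo fun x hx => toReal_density_smul hψ_nonneg hx m
  rw [this, integral_const_mul]
  ring

end ParameterDensity

/-! ### The main theorem. -/

theorem mainTheorem1
    {Ω : Type*} [MeasurableSpace Ω] (P : Measure Ω) [IsProbabilityMeasure P]
    {Ω' : Type*} [MeasurableSpace Ω'] (Q : Measure Ω') [IsProbabilityMeasure Q]
    (lam β ψ₁ : ℝ) (hlam : 0 < lam) (hβ : β ∈ Set.Ioo (0 : ℝ) 1) (hψ₁ : 0 < ψ₁)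
    (ψ : ℝ → ℝ) (hψ_meas : AEMeasurable ψ (volume.restrict (Set.Ioo (0 : ℝ) 1)))
    (hψ_nonneg : ∀ x ∈ Set.Ioo (0 : ℝ) 1, 0 ≤ ψ x)
    (hψ_lim : Tendsto ψ (𝓝[<] 1) (𝓝 ψ₁))
    (α : ℕ → Ω → ℝ) (X : ℕ → ℕ → Ω → ℕ) (ε : ℕ → ℕ → Ω → ℕ) (ξ : ℕ → ℕ → ℕ → Ω → ℕ)
    (hX : ∀ j, IsRandomizedInar P lam (α j) (X j) (ε j) (ξ j))
    (hα : ∀ j, P.map (α j) = (volume.restrict (Set.Ioo (0 : ℝ) 1)).withDensity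
      (fun x => ENNReal.ofReal (ψ x * (1 - x) ^ β)))
    (hindep : iIndepFun (fun j ω => (α j ω, fun k => X j k ω)) P)
    (B : ℝ≥0 → Ω' → ℝ) (hB : IsFractionalBM (1 - β / 2) B Q) :
    IteratedFddLimit
      (fun N n t ω =>
        (n : ℝ) ^ (-1 + β / 2) * (N : ℝ) ^ (-(1 / 2) : ℝ) * aggregated P α X N n t ω)
      P
      (fun t ω => √(2 * lam * ψ₁ * Real.Gamma β / ((2 - β) * (1 - β))) * B t ω)
      Q := by
  have hindepD : iIndepFun (fun j ω k => (X j k ω : ℝ) - lam / (1 - α j ω)) P := by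
    refine hindep.comp (fun _ (p : ℝ × (ℕ → ℕ)) k => (p.2 k : ℝ) - lam / (1 - p.1)) fun _ => ?_
    refine measurable_pi_lambda _ fun k => Measurable.sub ?_ (by fun_prop)
    exact (measurable_of_countable (fun l : ℕ => (l : ℝ))).comp
      ((measurable_pi_apply k).comp measurable_snd)
  have hprob : ∀ j, IsProbabilityMeasure (P.map (α j)) := fun j =>
    Measure.isProbabilityMeasure_map (hX j).measurable_param.aemeasurable
  have h_int : ∀ j, Integrable (fun x => lam / (1 - x)) (P.map (α j)) := fun j =>
    integrable_div_one_sub_of_density hβ hψ_meas hψ_nonneg hψ_lim (hα j)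
  have hΓ : 0 < Real.Gamma β := Real.Gamma_pos_of_pos hβ.1
  -- The general theorem is applied to the process centred by `lam / (1 - α)`; every copy has the
  -- covariances of the copy with index `0`, since all parameters share one law.
  obtain ⟨ν, h1, h2⟩ := iteratedFddLimit_of_covariance (P := P) (Q := Q) hβ
    (c := lam * (ψ₁ * Real.Gamma β)) (by positivity)
    (D := fun j k ω => (X j k ω : ℝ) - lam / (1 - α j ω))
    (r := fun d => ∫ x, x ^ d * (lam / (1 - x)) ∂(P.map (α 0)))
    (tendsto_rpow_mul_integral_density hβ hψ_meas hψ_nonneg hψ_lim (hα 0))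
    (fun k => (hX 0).memLp_centred hlam.le (h_int 0) k)
    (fun k => (hX 0).integral_centred hlam.le (h_int 0) k)
    (fun k l => (hX 0).integral_centred_mul hlam.le (h_int 0) k l)
    hindepD (fun j => (hX j).identDistrib_centred (hX 0) ((hα j).trans (hα 0).symm)) hB
  have hconst : 2 * (lam * (ψ₁ * Real.Gamma β)) / ((1 - β) * (2 - β))
      = 2 * lam * ψ₁ * Real.Gamma β / ((2 - β) * (1 - β)) := by
    rw [mul_comm (1 - β)]
    ring
  rw [hconst] at h2
  refine ⟨ν, fun n hn I => (h1 n hn I).congr (fun N => ?_) (.of_forall fun _ => rfl), h2⟩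
  -- Countably many null sets are discarded together, so the conditional expectations in
  -- `aggregated` may be replaced for all `j` and `k` at once.
  have hae : ∀ᵐ ω ∂P, ∀ j k, (P[fun ω' => (X j k ω' : ℝ) | sigmaOf (α j)]) ω
      = lam / (1 - α j ω) :=
    ae_all_iff.2 fun j => ae_all_iff.2 fun k => (hX j).condExp_eq hlam.le (h_int j) k
  filter_upwards [hae] with ω hω
  simp only [aggregated, hω]
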